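/- A partition is identified with its Ferrers diagram and the empty partition is included; $\mathcal P$ is the set of all partitions and $\mathcal{SC}$ the set of self-conjugate ones ($\lambda=\lambda'$). For a partition $\lambda$, let $|\lambda|$ be its size, $\mathcal H(\lambda)$ the multiset of its hook-lengths, and $\mathcal H_t(\lambda)$ the multiset of those hook-lengths that are divisible by $t$. The BG-rank of $\lambda$ is $\mathrm{BG}(\lambda)=\sum_{(i,j)\in\lambda}(-1)^{i+j}$, the sum being over the boxes (row $i$, column $j$) of the Ferrers diagram, so that the box $(1,1)$ counts $+1$. For formal power series $a,p$ in $q$, where $p$ has zero constant term, put $(a;p)_\infty=\prod_{j\ge 0}(1-ap^j)$. **Theorem.** Let $t$ be a positive even integer, let $R$ be a commutative ring, $x\in R$, $b\in R^\times$ (for instance, $R=\mathbb C[x,b,b^{-1}]$ with $x,b$ indeterminates), and let $\rho_1,\rho_2:\mathbb N\to R$ be arbitrary functions. Define the formal power series in $R[[q]]$ $$f_t(q)=\sum_{\nu\in\mathcal P}q^{|\nu|}\prod_{h\in\mathcal H(\nu)}\rho_1(th)^2,\qquad g_t(q)=\sum_{\nu\in\mathcal P}q^{|\nu|}\prod_{h\in\mathcal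 H(\nu)}\rho_1(th)^2\sum_{h\in\mathcal H(\nu)}\rho_2(th).$$ Then, in $R[[q]]$, $$\sum_{\lambda\in\mathcal{SC}}q^{|\lambda|}x^{|\mathcal H_t(\lambda)|}b^{\mathrm{BG}(\lambda)}\prod_{h\in\mathcal H_t(\lambda)}\rho_1(h)\sum_{h\in\mathcal H_t(\lambda)}\rho_2(h) = t\,\bigl(f_t(x^2q^{2t})\bigr)^{t/2-1}\,g_t(x^2q^{2t})\,(q^{2t};q^{2t})_\infty^{t/2}\,(-bq;q^4)_\infty\,(-q^3/b;q^4)_\infty .$$ -/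

import Mathlib

open PowerSeries

noncomputable section

namespace SelfConj

/-! Partitions are represented by their Ferrers diagrams, i.e. by Mathlib's `YoungDiagram`
(matrix coordinates `(row, column)` starting from `(0, 0)`); `μ.card` is the size `|μ|` and
`μ.transpose` the conjugate partition. The empty partition is included. -/

/-- The set of self-conjugate partitions. -/
def SC : Set YoungDiagram := {μ | μ.transpose = μ}

/-- The hook-length of the box `v` of `μ`: the number of boxes `u` of `μ` that are `v` itself, or
lie to the right of `v` in the same row, or lie below `v` in the same column. -/
def hookLength (μ : YoungDiagram) (v : ℕ × ℕ) : ℕ :=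
  (μ.cells.filter fun u => (u.1 = v.1 ∧ v.2 ≤ u.2) ∨ (u.2 = v.2 ∧ v.1 ≤ u.1)).card

/-- The multiset `H(μ)` of all hook-lengths of `μ`. -/
def hooks (μ : YoungDiagram) : Multiset ℕ := μ.cells.val.map (hookLength μ)

/-- The multiset `H_t(μ)` of all hook-lengths of `μ` that are multiples of `t`. -/
def hooksMod (t : ℕ) (μ : YoungDiagram) : Multiset ℕ := (hooks μ).filter (t ∣ ·)

/-- The BG-rank: the sum over the boxes of alternating signs, with `+1` in the top left box. -/
def bgRank (μ : YoungDiagram) : ℤ := ∑ c ∈ μ.cells, (-1) ^ (c.1 + c.2)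

/-- There are finitely many partitions of `n`. -/
theorem finite_card_eq (S : Set YoungDiagram) (n : ℕ) : {μ | μ ∈ S ∧ μ.card = n}.Finite := by
  have hinj : Function.Injective (YoungDiagram.cells) := fun μ ν h => YoungDiagram.ext h
  refine Set.Finite.subset (Set.Finite.preimage hinj.injOn
    (Finset.finite_toSet (Finset.powerset (Finset.range n ×ˢ Finset.range n)))) ?_
  rintro μ ⟨-, rfl⟩
  simp only [Set.mem_preimage, Finset.mem_coe, Finset.mem_powerset]
  rintro ⟨i, j⟩ hc
  have h1 : i < μ.colLen j := YoungDiagram.mem_iff_lt_colLen.1 hc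
  have h2 : j < μ.rowLen i := YoungDiagram.mem_iff_lt_rowLen.1 hc
  rw [YoungDiagram.colLen_eq_card] at h1
  rw [YoungDiagram.rowLen_eq_card] at h2
  have h3 : (μ.col j).card ≤ μ.card := Finset.card_le_card (Finset.filter_subset _ _)
  have h4 : (μ.row i).card ≤ μ.card := Finset.card_le_card (Finset.filter_subset _ _)
  simp only [Finset.mem_product, Finset.mem_range]
  exact ⟨h1.trans_le h3, h2.trans_le h4⟩

/-- The formal power series `∑_{μ ∈ S} w(μ) q^{|μ|}`: the coefficient of `q ^ n` is the finite sum
of the weights `w(μ)` over the partitions `μ ∈ S` of size `n`. -/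
def genFun {R : Type*} [CommRing R] (S : Set YoungDiagram) (w : YoungDiagram → R) : R⟦X⟧ :=
  PowerSeries.mk fun n => ∑ μ ∈ (finite_card_eq S n).toFinset, w μ

/-- `f_t(q) = ∑_ν q^{|ν|} ∏_{h ∈ H(ν)} ρ₁(th)²`, over all partitions `ν`. -/
def fSeries {R : Type*} [CommRing R] (t : ℕ) (ρ₁ : ℕ → R) : R⟦X⟧ :=
  genFun Set.univ fun ν => ((hooks ν).map fun h => ρ₁ (t * h) ^ 2).prod

/-- `g_t(q) = ∑_ν q^{|ν|} ∏_{h ∈ H(ν)} ρ₁(th)² ∑_{h ∈ H(ν)} ρ₂(th)`, over all partitions `ν`. -/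
def gSeries {R : Type*} [CommRing R] (t : ℕ) (ρ₁ ρ₂ : ℕ → R) : R⟦X⟧ :=
  genFun Set.univ fun ν =>
    ((hooks ν).map fun h => ρ₁ (t * h) ^ 2).prod * ((hooks ν).map fun h => ρ₂ (t * h)).sum

open scoped PowerSeries.WithPiTopology in
/-- The infinite `q`-Pochhammer symbol `(a; p)_∞ = ∏_{j ≥ 0} (1 - a p^j)` of formal power series,
as an infinite product that converges coefficientwise (each coefficient is eventually constant). -/
def qPochInf {R : Type*} [CommRing R] (a p : R⟦X⟧) : R⟦X⟧ :=
  letI : TopologicalSpace R := ⊥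
  ∏' j : ℕ, (1 - a * p ^ j)

open scoped PowerSeries.WithPiTopology in
/-- The product `(a; p)_∞` converges whenever `p` has no constant term. -/
theorem hasProd_qPochInf {R : Type*} [CommRing R] (a p : R⟦X⟧) (hp : constantCoeff p = 0) :
    letI : TopologicalSpace R := ⊥
    HasProd (fun j : ℕ => 1 - a * p ^ j) (qPochInf a p) := by
  let _ : TopologicalSpace R := ⊥
  refine Multipliable.hasProd ?_
  simp_rw [sub_eq_add_neg]
  apply PowerSeries.WithPiTopology.multipliable_one_add_of_tendsto_order_atTop_nhds_top
  refine ENat.tendsto_nhds_top_iff_natCast_lt.2 fun n => ?_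
  filter_upwards [Filter.eventually_gt_atTop n] with j hj
  rw [PowerSeries.order_neg]
  have h1 : (j : ℕ∞) ≤ (p ^ j).order := le_order_pow_of_constantCoeff_eq_zero j hp
  have h2 : (p ^ j).order ≤ (a * p ^ j).order := le_trans le_add_self (le_order_mul a (p ^ j))
  exact lt_of_lt_of_le (Nat.cast_lt.2 hj) (h1.trans h2)

end SelfConj

end

open PowerSeries

noncomputable section

namespace SelfConj

/-! Encode a partition `λ` with a charge `c` by its Maya diagram, the set of integers `λ_i - i - 1 +
c`. Boxes correspond to pairs of an element and a smaller gap, and hook-lengths to their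
differences. With `t = 2m`, the hook-lengths divisible by `t` are thus `t` times the differences
inside the residue classes modulo `t`, and each class is again the Maya diagram of a charged
partition. At charge `0`, conjugation is the reflection `k ↦ -1 - k`, which exchanges the classes
`r` and `t - 1 - r`. So a self-conjugate partition amounts to an arbitrary family of `m` charged
partitions `(c_r, ν_r)`, `r < m` (`chargedQuotientEquiv`), and each `t • H(ν_r)` occurs twice in
`H_t(λ)` (`hooksMod_eq_sum`).

Size and BG-rank are regularized sums of a function over the Maya diagram (`regSum`), so they split
over residue classes: `|λ|` is a sum of terms depending on `c_r` alone plus `4m|ν_r|`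
(`card_eq_sum`), and the BG-rank is `∑ (-1)^r c_r` (`bgRank_eq_sum`). A multiplicative weight
therefore factors into charge series and quotient series (`weightedSeries_SC_prod`). The sum of `ρ₂`
singles out one of the `m` quotients, each counted twice, whence the factor `t = 2m`.

The product of the charge series is found without the Jacobi triple product (`prod_coreSeries`).
With trivial quotient weights, the same factorization expresses `∑ q^|λ| b^BG` over `SC`, and that
series is also computed directly from the diagonal hooks (`genFun_SC_bgRank`). Euler's partition
product then isolates the charge factor. -/

/-- The series `∑ i, w i * X ^ s i` over an index type on which `s` has finite fibres. -/
def weightedSeries {ι R : Type*} [CommRing R] (s : ι → ℕ) (w : ι → R) : R⟦X⟧ :=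
  PowerSeries.mk fun n => ∑ᶠ i ∈ {i | s i = n}, w i

/-- All fibres of the size function are finite. -/
def FiniteFibres {ι : Type*} (s : ι → ℕ) : Prop := ∀ n, {i | s i = n}.Finite

/-! ### Algebra of series indexed by a type with a size function -/

section weightedSeries

variable {ι κ R : Type*} [CommRing R]

theorem FiniteFibres.comp_injective {s : ι → ℕ} (hs : FiniteFibres s) {e : κ → ι}
    (he : Function.Injective e) : FiniteFibres fun k => s (e k) := fun n =>
  (hs n).preimage he.injOn

theorem FiniteFibres.finite_le {s : ι → ℕ} (hs : FiniteFibres s) (n : ℕ) :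
    {i | s i ≤ n}.Finite := by
  refine ((Set.finite_Iic n).biUnion fun k _ => hs k).subset ?_
  intro i hi
  simpa using hi

theorem FiniteFibres.prod {s : ι → ℕ} {s' : κ → ℕ} (hs : FiniteFibres s)
    (hs' : FiniteFibres s') : FiniteFibres fun p : ι × κ => s p.1 + s' p.2 := by
  intro n
  refine ((hs.finite_le n).prod (hs'.finite_le n)).subset ?_
  rintro ⟨i, j⟩ hij
  simp only [Set.mem_ofPred_eq, Set.mem_prod] at hij ⊢
  omega

theorem coeff_weightedSeries {s : ι → ℕ} (hs : FiniteFibres s) (w : ι → R) (n : ℕ) :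
    coeff n (weightedSeries s w) = ∑ i ∈ (hs n).toFinset, w i := by
  rw [weightedSeries, coeff_mk, finsum_mem_eq_finite_toFinset_sum _ (hs n)]

theorem weightedSeries_equiv (e : κ ≃ ι) (s : ι → ℕ) (w : ι → R) :
    weightedSeries (fun k => s (e k)) (fun k => w (e k)) = weightedSeries s w := by
  ext n
  simp only [weightedSeries, coeff_mk]
  exact finsum_mem_eq_of_bijOn e
    ⟨fun k hk => hk, e.injective.injOn, fun i hi => ⟨e.symm i, by simpa using hi, by simp⟩⟩
    fun _ _ => rfl

theorem weightedSeries_mul {s : ι → ℕ} {s' : κ → ℕ} (hs : FiniteFibres s)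
    (hs' : FiniteFibres s') (w : ι → R) (w' : κ → R) :
    weightedSeries (fun p : ι × κ => s p.1 + s' p.2) (fun p => w p.1 * w' p.2) =
      weightedSeries s w * weightedSeries s' w' := by
  classical
  ext n
  rw [coeff_weightedSeries (hs.prod hs'), coeff_mul]
  rw [← Finset.sum_fiberwise_of_maps_to (t := Finset.HasAntidiagonal.antidiagonal n)
    (g := fun p : ι × κ => (s p.1, s' p.2)) (by simp)]
  refine Finset.sum_congr rfl ?_
  rintro ⟨a, b⟩ hab
  rw [coeff_weightedSeries hs, coeff_weightedSeries hs', Finset.sum_mul_sum,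
    ← Finset.sum_product']
  refine Finset.sum_congr ?_ fun _ _ => rfl
  ext ⟨i, j⟩
  simp only [Finset.mem_filter, Set.Finite.mem_toFinset, Set.mem_ofPred_eq, Prod.mk.injEq,
    Finset.mem_product, Finset.HasAntidiagonal.mem_antidiagonal] at hab ⊢
  constructor
  · exact fun h => h.2
  · rintro ⟨rfl, rfl⟩
    exact ⟨hab, rfl, rfl⟩

theorem weightedSeries_unique [Unique ι] (w : ι → R) :
    weightedSeries (fun _ : ι => 0) w = C (w default) := by
  ext n
  have hs : FiniteFibres (fun _ : ι => 0) := fun n => Set.toFinite _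
  rw [coeff_weightedSeries hs, coeff_C]
  split_ifs with h
  · subst h
    rw [show (hs 0).toFinset = {default} from by ext i; simp [Unique.eq_default]]
    simp
  · apply Finset.sum_eq_zero
    intro i hi
    simp only [Set.Finite.mem_toFinset, Set.mem_ofPred_eq] at hi
    exact absurd hi.symm h

theorem finiteFibres_pi : ∀ {m : ℕ} {s : Fin m → ι → ℕ}, (∀ r, FiniteFibres (s r)) →
    FiniteFibres fun v : Fin m → ι => ∑ r, s r (v r)
  | 0, _, _ => fun _ => Set.toFinite _
  | m + 1, s, hs => by
    have h := ((hs 0).prod (finiteFibres_pi fun r : Fin m => hs r.succ)).comp_injective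
      (Fin.consEquiv fun _ : Fin (m + 1) => ι).symm.injective
    refine (fun n => (h n).subset ?_)
    intro v hv
    simpa [Fin.sum_univ_succ, Fin.consEquiv, Fin.tail] using hv

theorem weightedSeries_pi : ∀ {m : ℕ} {s : Fin m → ι → ℕ} (_ : ∀ r, FiniteFibres (s r))
    (w : Fin m → ι → R),
    weightedSeries (fun v : Fin m → ι => ∑ r, s r (v r)) (fun v => ∏ r, w r (v r)) =
      ∏ r, weightedSeries (s r) (w r)
  | 0, _, _, w => by simp [weightedSeries_unique]
  | m + 1, s, hs, w => by
    rw [Fin.prod_univ_succ, ← weightedSeries_pi (fun r : Fin m => hs r.succ),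
      ← weightedSeries_mul (hs 0) (finiteFibres_pi fun r : Fin m => hs r.succ),
      ← weightedSeries_equiv (Fin.consEquiv fun _ : Fin (m + 1) => ι)]
    simp [Fin.sum_univ_succ, Fin.prod_univ_succ, Fin.consEquiv]

theorem weightedSeries_sum {α : Type*} (A : Finset α) {s : ι → ℕ} (hs : FiniteFibres s)
    (w : α → ι → R) :
    weightedSeries s (fun i => ∑ a ∈ A, w a i) = ∑ a ∈ A, weightedSeries s (w a) := by
  ext n
  simp only [coeff_weightedSeries hs, map_sum]
  exact Finset.sum_comm

theorem weightedSeries_smul {s : ι → ℕ} (hs : FiniteFibres s) (a : R)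
    (w : ι → R) :
    weightedSeries s (fun i => a * w i) = C a * weightedSeries s w := by
  ext n
  simp only [coeff_weightedSeries hs, coeff_C_mul, Finset.mul_sum]

theorem hasSum_weightedSeries [TopologicalSpace R] {s : ι → ℕ} (hs : FiniteFibres s)
    (w : ι → R) :
    let _ := PowerSeries.WithPiTopology.instTopologicalSpace R
    HasSum (fun i => C (w i) * X ^ s i) (weightedSeries s w) := by
  let _ := PowerSeries.WithPiTopology.instTopologicalSpace R
  rw [PowerSeries.WithPiTopology.hasSum_iff_hasSum_coeff]
  intro n
  have h : coeff n (weightedSeries s w) =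
      ∑ i ∈ (hs n).toFinset, coeff n (C (w i) * X ^ s i) := by
    rw [coeff_weightedSeries hs]
    refine Finset.sum_congr rfl fun i hi => ?_
    simp only [Set.Finite.mem_toFinset, Set.mem_ofPred_eq] at hi
    simp [coeff_X_pow, hi]
  rw [h]
  refine hasSum_sum_of_ne_finset_zero fun i hi => ?_
  simp only [Set.Finite.mem_toFinset, Set.mem_ofPred_eq] at hi
  simp [coeff_X_pow, Ne.symm hi]

/-- Substituting `q ↦ a q^N` acts term by term. The condition `0 < N` makes the substitution legal
and keeps the fibres finite. -/
theorem weightedSeries_subst {s : ι → ℕ} (hs : FiniteFibres s) (w : ι → R) (a : R) {N : ℕ}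
    (hN : 0 < N) :
    (weightedSeries s w).subst (C a * X ^ N : R⟦X⟧) =
      weightedSeries (fun i => N * s i) (fun i => a ^ s i * w i) := by
  have hsub : HasSubst (C a * X ^ N : R⟦X⟧) :=
    HasSubst.of_constantCoeff_zero' (by simp [hN.ne'])
  have hs' : FiniteFibres fun i => N * s i := by
    intro n
    refine (hs (n / N)).subset ?_
    rintro i rfl
    simp [hN]
  ext n
  rw [coeff_subst' hsub, coeff_weightedSeries hs']
  have key : ∀ d, coeff d (weightedSeries s w) • coeff n ((C a * X ^ N : R⟦X⟧) ^ d) =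
      if N * d = n then ∑ i ∈ (hs d).toFinset, a ^ s i * w i else 0 := by
    intro d
    rw [mul_pow, ← pow_mul, ← map_pow, coeff_C_mul, coeff_X_pow, coeff_weightedSeries hs]
    by_cases h : N * d = n
    · simp only [h, if_true, mul_one, smul_eq_mul, Finset.sum_mul]
      refine Finset.sum_congr rfl fun i hi => ?_
      simp only [Set.Finite.mem_toFinset, Set.mem_ofPred_eq] at hi
      rw [hi, mul_comm]
    · simp [h, Ne.symm h]
  rw [finsum_congr key]
  by_cases hd : N ∣ n
  · obtain ⟨d, rfl⟩ := hd
    rw [finsum_eq_single _ d]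
    · rw [if_pos rfl]
      refine Finset.sum_congr ?_ fun _ _ => rfl
      ext i
      simp [hN.ne']
    · intro d' hd'
      rw [if_neg]
      intro h
      exact hd' (Nat.eq_of_mul_eq_mul_left hN h)
  · rw [finsum_eq_zero_of_forall_eq_zero, Finset.sum_eq_zero]
    · intro i hi
      simp only [Set.Finite.mem_toFinset, Set.mem_ofPred_eq] at hi
      exact absurd ⟨_, hi.symm⟩ hd
    · intro d
      rw [if_neg]
      rintro rfl
      exact hd ⟨_, rfl⟩

end weightedSeries

/-! ### Generating functions of partitions as weighted series -/

theorem finiteFibres_card (S : Set YoungDiagram) : FiniteFibres fun μ : S => μ.1.card := by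
  intro n
  refine ((finite_card_eq S n).preimage Subtype.val_injective.injOn).subset ?_
  intro μ hμ
  exact ⟨μ.2, hμ⟩

theorem genFun_eq_weightedSeries {R : Type*} [CommRing R] (S : Set YoungDiagram)
    (w : YoungDiagram → R) : genFun S w = weightedSeries (fun μ : S => μ.1.card) fun μ => w μ := by
  classical
  ext n
  rw [coeff_weightedSeries (finiteFibres_card S), genFun, coeff_mk]
  symm
  refine Finset.sum_bij (fun μ _ => μ.1) ?_ ?_ ?_ ?_
  · intro μ hμ
    simp only [Set.Finite.mem_toFinset, Set.mem_ofPred_eq] at hμ ⊢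
    exact ⟨μ.2, hμ⟩
  · intro μ _ ν _ h
    exact Subtype.ext h
  · intro μ hμ
    simp only [Set.Finite.mem_toFinset, Set.mem_ofPred_eq] at hμ
    exact ⟨⟨μ, hμ.1⟩, by simpa using hμ.2, rfl⟩
  · intros; rfl

theorem finiteFibres_youngDiagram_card : FiniteFibres YoungDiagram.card := by
  intro n
  refine (finite_card_eq Set.univ n).subset ?_
  intro μ hμ
  exact ⟨trivial, hμ⟩

theorem genFun_univ {R : Type*} [CommRing R] (w : YoungDiagram → R) :
    genFun Set.univ w = weightedSeries YoungDiagram.card w := by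
  rw [genFun_eq_weightedSeries, ← weightedSeries_equiv (Equiv.Set.univ YoungDiagram)]
  rfl

/-! ### Maya diagrams -/

/-- The Maya diagram of charge `c` of the partition `μ`. -/
def maya (c : ℤ) (μ : YoungDiagram) : Set ℤ := Set.range fun i : ℕ => (μ.rowLen i : ℤ) - i - 1 + c

/-- Sets of integers containing all small enough integers and no large enough integer. -/
def IsMaya (S : Set ℤ) : Prop :=
  ∃ N : ℕ, (∀ k : ℤ, k < -N → k ∈ S) ∧ ∀ k : ℤ, (N : ℤ) ≤ k → k ∉ S

theorem lt_rowLen_iff_lt_colLen (μ : YoungDiagram) (i j : ℕ) :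
    j < μ.rowLen i ↔ i < μ.colLen j :=
  YoungDiagram.mem_iff_lt_rowLen.symm.trans YoungDiagram.mem_iff_lt_colLen

theorem rowLen_sub_ne (μ : YoungDiagram) (i j : ℕ) :
    (μ.rowLen i : ℤ) - i - 1 ≠ j - μ.colLen j := by
  have := lt_rowLen_iff_lt_colLen μ i j
  omega

/-- Together with `rowLen_sub_ne`: every unit step of the boundary path is either the end of a row
or the end of a column, so rows give the elements and columns the gaps. -/
theorem exists_rowLen_or_colLen (μ : YoungDiagram) (k : ℤ) :
    (∃ i : ℕ, (μ.rowLen i : ℤ) - i - 1 = k) ∨ ∃ j : ℕ, (j : ℤ) - μ.colLen j = k := by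
  classical
  have hex : ∃ i : ℕ, (μ.rowLen i : ℤ) - i - 1 ≤ k := by
    refine ⟨μ.rowLen 0 + k.natAbs, ?_⟩
    have := μ.rowLen_anti 0 (μ.rowLen 0 + k.natAbs) (Nat.zero_le _)
    omega
  -- Take the first row whose label is at most `k`. If it misses `k`, the step labelled `k` ends
  -- column `k + i`, which has length `i`.
  obtain ⟨i, hi, hmin⟩ : ∃ i : ℕ, (μ.rowLen i : ℤ) - i - 1 ≤ k ∧
      ∀ i' < i, k < (μ.rowLen i' : ℤ) - i' - 1 :=
    ⟨Nat.find hex, Nat.find_spec hex, fun i' h => not_le.1 (Nat.find_min hex h)⟩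
  rcases hi.eq_or_lt with h | h
  · exact Or.inl ⟨i, h⟩
  · right
    refine ⟨(k + i).toNat, ?_⟩
    have h1 := lt_rowLen_iff_lt_colLen μ i (k + i).toNat
    rcases Nat.eq_zero_or_pos i with rfl | hpos
    · omega
    · have h2 := lt_rowLen_iff_lt_colLen μ (i - 1) (k + i).toNat
      have h3 := hmin (i - 1) (by omega)
      omega

theorem notMem_maya {c : ℤ} {μ : YoungDiagram} {k : ℤ} :
    k ∉ maya c μ ↔ ∃ j : ℕ, (j : ℤ) - μ.colLen j + c = k := by
  constructor
  · intro h
    rcases exists_rowLen_or_colLen μ (k - c) with ⟨i, hi⟩ | ⟨j, hj⟩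
    · exact absurd ⟨i, by simp [hi]⟩ h
    · exact ⟨j, by omega⟩
  · rintro ⟨j, hj⟩ ⟨i, hi⟩
    have := rowLen_sub_ne μ i j
    simp only at hi
    omega

theorem isMaya_maya (c : ℤ) (μ : YoungDiagram) : IsMaya (maya c μ) := by
  refine ⟨μ.colLen 0 + μ.rowLen 0 + c.natAbs, fun k hk => ?_, ?_⟩
  · by_contra h
    obtain ⟨j, hj⟩ := notMem_maya.1 h
    have := μ.colLen_anti 0 j (Nat.zero_le _)
    omega
  · rintro k hk ⟨i, hi⟩
    have := μ.rowLen_anti 0 i (Nat.zero_le _)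
    simp only at hi
    omega

/-! ### Recovering the charge and the partition from a Maya diagram -/

section count

/-- The number of elements of `S` that are at least `k`. -/
def countGE (S : Set ℤ) (k : ℤ) : ℕ := (S ∩ Set.Ici k).ncard

variable {S : Set ℤ}

theorem IsMaya.finite_inter_Ici (hS : IsMaya S) (k : ℤ) : (S ∩ Set.Ici k).Finite := by
  obtain ⟨N, -, hN⟩ := hS
  refine (Set.finite_Ico k N).subset ?_
  rintro a ⟨ha, hk⟩
  refine ⟨hk, ?_⟩
  by_contra h
  exact hN a (not_lt.1 h) ha

theorem countGE_of_mem (hS : IsMaya S) {k : ℤ} (hk : k ∈ S) :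
    countGE S k = countGE S (k + 1) + 1 := by
  rw [countGE, countGE, ← Set.ncard_insert_of_notMem _ (hS.finite_inter_Ici (k + 1))]
  · congr 1
    ext a
    simp only [Set.mem_inter_iff, Set.mem_Ici, Set.mem_insert_iff]
    constructor
    · rintro ⟨ha, h⟩
      rcases h.eq_or_lt with h | h
      · exact Or.inl h.symm
      · exact Or.inr ⟨ha, h⟩
    · rintro (rfl | ⟨ha, h⟩)
      · exact ⟨hk, le_rfl⟩
      · exact ⟨ha, by omega⟩
  · simp

theorem countGE_of_notMem {k : ℤ} (hk : k ∉ S) : countGE S k = countGE S (k + 1) := by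
  rw [countGE, countGE]
  congr 1
  ext a
  simp only [Set.mem_inter_iff, Set.mem_Ici]
  constructor
  · rintro ⟨ha, h⟩
    rcases h.eq_or_lt with h | h
    · exact absurd (h ▸ ha) hk
    · exact ⟨ha, h⟩
  · rintro ⟨ha, h⟩
    exact ⟨ha, by omega⟩

theorem countGE_step (hS : IsMaya S) (k : ℤ) :
    countGE S (k + 1) ≤ countGE S k ∧ countGE S k ≤ countGE S (k + 1) + 1 := by
  by_cases hk : k ∈ S
  · rw [countGE_of_mem hS hk]; omega
  · rw [countGE_of_notMem hk]; omega

theorem countGE_anti (hS : IsMaya S) {k l : ℤ} (h : k ≤ l) : countGE S l ≤ countGE S k := by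
  induction l, h using Int.leInduction with
  | base => rfl
  | succ l _ ih => exact (countGE_step hS l).1.trans ih

theorem countGE_add_mono (hS : IsMaya S) {k l : ℤ} (h : k ≤ l) :
    countGE S k + k ≤ countGE S l + l := by
  induction l, h using Int.leInduction with
  | base => rfl
  | succ l _ ih =>
    have := (countGE_step hS l).2
    omega

/-- The box `(i, j)` must belong to the partition exactly when row `i` has an element at least `j -
i + c`, that is, when more than `i` elements of `S` are at least `j - i + c`. -/
theorem exists_maya_eq (hS : IsMaya S) : ∃ c μ, maya c μ = S := by
  obtain ⟨N, hlow, hhigh⟩ := id hS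
  -- The charge is the constant value of `countGE S k + k` for `k ≤ -N`.
  obtain ⟨c, hc⟩ : ∃ c : ℤ, c = countGE S (-N) - N := ⟨_, rfl⟩
  have hlo : ∀ k : ℤ, k ≤ -N → (countGE S k : ℤ) + k = c := by
    intro k hk
    induction k, hk using Int.leInductionDown with
    | base => omega
    | pred k hk ih =>
      have := countGE_of_mem hS (hlow (k - 1) (by omega))
      rw [sub_add_cancel] at this
      omega
  have hge : ∀ k : ℤ, c ≤ countGE S k + k := by
    intro k
    rcases le_total k (-N) with h | h
    · exact (hlo k h).ge
    · have := countGE_add_mono hS h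
      omega
  have hhi : ∀ k : ℤ, (N : ℤ) ≤ k → countGE S k = 0 := by
    intro k hk
    rw [countGE, Set.ncard_eq_zero (hS.finite_inter_Ici k)]
    ext a
    simp only [Set.mem_inter_iff, Set.mem_Ici, Set.mem_empty_iff_false, iff_false, not_and]
    intro ha h
    exact hhigh a (hk.trans h) ha
  -- The rectangle only ensures finiteness; `hmem` shows that it imposes no condition.
  let cells : Finset (ℕ × ℕ) :=
    ((Finset.range (countGE S (-N))) ×ˢ Finset.range (2 * N)).filter
      fun p => p.1 < countGE S (p.2 - p.1 + c)
  have hmem : ∀ i j : ℕ, (i, j) ∈ cells ↔ i < countGE S (j - i + c) := by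
    intro i j
    simp only [cells, Finset.mem_filter, Finset.mem_product, Finset.mem_range,
      and_iff_right_iff_imp]
    intro h
    have h1 := hlo (j - i + c)
    have h2 := hhi (j - i + c)
    have h3 : -(N : ℤ) ≤ j - i + c → _ := fun h => countGE_anti hS h
    omega
  let μ : YoungDiagram :=
    { cells := cells
      isLowerSet := by
        rintro ⟨i, j⟩ ⟨i', j'⟩ ⟨h1, h2⟩ h
        simp only [Finset.mem_coe, hmem] at h h1 h2 ⊢
        have h3 : countGE S (j - i' + c) ≤ countGE S (j' - i' + c) :=
          countGE_anti hS (by omega)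
        have h4 : (countGE S (j - i + c) : ℤ) + (j - i + c) ≤
          countGE S (j - i' + c) + (j - i' + c) := countGE_add_mono hS (by omega)
        omega }
  have hrow : ∀ i j : ℕ, j < μ.rowLen i ↔ i < countGE S (j - i + c) := fun i j => by
    rw [← hmem, ← YoungDiagram.mem_iff_lt_rowLen]; rfl
  have hcol : ∀ i j : ℕ, i < μ.colLen j ↔ i < countGE S (j - i + c) := fun i j => by
    rw [← hmem, ← YoungDiagram.mem_iff_lt_colLen]; rfl
  refine ⟨c, μ, ?_⟩
  ext k
  by_cases hk : k ∈ S
  · simp only [hk, iff_true]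
    have h1 := countGE_of_mem hS hk
    have h2 := hge (k + 1)
    -- The row of the element `k` is the number of larger elements, and `j` is the length of that
    -- row.
    obtain ⟨i, hi⟩ : ∃ i, i = countGE S (k + 1) := ⟨_, rfl⟩
    obtain ⟨j, hj⟩ : ∃ j : ℕ, (j : ℤ) = k + 1 + i - c := ⟨(k + 1 + i - c).toNat, by omega⟩
    refine ⟨i, ?_⟩
    have h3 := hrow i j
    rw [show (j : ℤ) - i + c = k + 1 by omega] at h3
    have h4 := hrow i (j - 1)
    simp only
    rcases Nat.eq_zero_or_pos j with rfl | hpos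
    · omega
    · rw [show ((j - 1 : ℕ) : ℤ) - i + c = k by omega] at h4
      omega
  · simp only [hk, iff_false, notMem_maya]
    have h1 := countGE_of_notMem hk
    have h2 := hge k
    -- For a gap, `j` is its column and `i` the length of that column.
    obtain ⟨i, hi⟩ : ∃ i, i = countGE S k := ⟨_, rfl⟩
    obtain ⟨j, hj⟩ : ∃ j : ℕ, (j : ℤ) = k + i - c := ⟨(k + i - c).toNat, by omega⟩
    refine ⟨j, ?_⟩
    have h3 := hcol i j
    rw [show (j : ℤ) - i + c = k by omega] at h3
    have h4 := hcol (i - 1) j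
    rcases Nat.eq_zero_or_pos i with rfl | hpos
    · omega
    · rw [show (j : ℤ) - (i - 1 : ℕ) + c = k + 1 by omega] at h4
      omega

end count

theorem maya_injective_of_charge {c : ℤ} {μ ν : YoungDiagram} (h : maya c μ = maya c ν) :
    μ = ν := by
  -- The labels decrease strictly with the row, so their range determines them; the order dual turns
  -- this into `StrictMono`.
  have hmono : ∀ μ : YoungDiagram, StrictMono fun i : ℕ =>
      OrderDual.toDual ((μ.rowLen i : ℤ) - i - 1 + c) := by
    intro μ i j hij
    have := μ.rowLen_anti i j hij.le
    simp only [OrderDual.toDual_lt_toDual]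
    omega
  have hrow := (StrictMono.range_inj (hmono μ) (hmono ν)).1 (by
    simpa only [Set.range_comp' OrderDual.toDual, maya] using congrArg (OrderDual.toDual '' ·) h)
  ext ⟨i, j⟩
  have hi := congrFun hrow i
  simp only [EmbeddingLike.apply_eq_iff_eq] at hi
  rw [YoungDiagram.mem_cells, YoungDiagram.mem_cells, YoungDiagram.mem_iff_lt_rowLen,
    YoungDiagram.mem_iff_lt_rowLen, show μ.rowLen i = ν.rowLen i by omega]

/-! ### Hook-lengths from Maya diagrams -/

theorem hookLength_eq (μ : YoungDiagram) {i j : ℕ} (h : (i, j) ∈ μ) :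
    (hookLength μ (i, j) : ℤ) = (μ.rowLen i - i - 1) - (j - μ.colLen j) := by
  have h1 := YoungDiagram.mem_iff_lt_rowLen.1 h
  have h2 := YoungDiagram.mem_iff_lt_colLen.1 h
  -- The corner is counted in the row strip, so the column strip starts at `i + 1`.
  have hcells : (μ.cells.filter fun u => (u.1 = i ∧ j ≤ u.2) ∨ (u.2 = j ∧ i ≤ u.1)) =
      ({i} ×ˢ Finset.Ico j (μ.rowLen i)) ∪ (Finset.Ico (i + 1) (μ.colLen j) ×ˢ {j}) := by
    ext ⟨a, b⟩
    have hr := YoungDiagram.mem_iff_lt_rowLen (μ := μ) (i := a) (j := b)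
    have hc := YoungDiagram.mem_iff_lt_colLen (μ := μ) (i := a) (j := b)
    simp only [Finset.mem_filter, YoungDiagram.mem_cells, Finset.mem_union, Finset.mem_product,
      Finset.mem_singleton, Finset.mem_Ico]
    constructor
    · rintro ⟨hm, (⟨rfl, hb⟩ | ⟨rfl, ha⟩)⟩
      · exact Or.inl ⟨rfl, hb, hr.1 hm⟩
      · rcases ha.eq_or_lt with rfl | ha
        · exact Or.inl ⟨rfl, le_rfl, hr.1 hm⟩
        · exact Or.inr ⟨⟨ha, hc.1 hm⟩, rfl⟩
    · rintro (⟨rfl, hb, hm⟩ | ⟨⟨ha, hm⟩, rfl⟩)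
      · exact ⟨hr.2 hm, Or.inl ⟨rfl, hb⟩⟩
      · exact ⟨hc.2 hm, Or.inr ⟨rfl, by omega⟩⟩
  rw [hookLength, hcells, Finset.card_union_of_disjoint]
  · simp only [Finset.card_product, Finset.card_singleton, Nat.card_Ico]
    omega
  · rw [Finset.disjoint_left]
    rintro ⟨a, b⟩ ha hb
    simp only [Finset.mem_product, Finset.mem_singleton, Finset.mem_Ico] at ha hb
    omega

/-- The inversions of `S`: an element of `S` together with a smaller integer outside `S`. -/
def inversions (S : Set ℤ) : Set (ℤ × ℤ) := {p | p.1 ∈ S ∧ p.2 ∉ S ∧ p.2 < p.1}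

/-- The multiset of differences of the inversions of `S`. -/
def mayaHooks (S : Set ℤ) : Multiset ℕ := ∑ᶠ p ∈ inversions S, {(p.1 - p.2).toNat}

/-- The multiset of differences divisible by `t` of the inversions of `S`. -/
def mayaHooksMod (t : ℕ) (S : Set ℤ) : Multiset ℕ :=
  ∑ᶠ p ∈ {p ∈ inversions S | (t : ℤ) ∣ p.1 - p.2}, {(p.1 - p.2).toNat}

theorem IsMaya.finite_inversions {S : Set ℤ} (hS : IsMaya S) : (inversions S).Finite := by
  obtain ⟨N, h1, h2⟩ := hS
  refine ((Set.finite_Icc (-N : ℤ) N).prod (Set.finite_Icc (-N : ℤ) N)).subset ?_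
  rintro ⟨a, b⟩ ⟨ha, hb, hab⟩
  have h3 : ¬ (N : ℤ) ≤ a := fun h => h2 a h ha
  have h4 : ¬ b < -(N : ℤ) := fun h => hb (h1 b h)
  simp only [Set.mem_prod, Set.mem_Icc] at hab ⊢
  omega

theorem mayaHooksMod_one (S : Set ℤ) : mayaHooksMod 1 S = mayaHooks S := by
  simp [mayaHooksMod, mayaHooks]

theorem hooksMod_one (μ : YoungDiagram) : hooksMod 1 μ = hooks μ := by
  simp [hooksMod]

/-- The box `(i, j)` goes to the element of row `i` paired with the gap of column `j`; the box lies
in `μ` exactly when the gap is the smaller of the two. -/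
theorem hooksMod_eq_mayaHooksMod (t : ℕ) (c : ℤ) (μ : YoungDiagram) :
    hooksMod t μ = mayaHooksMod t (maya c μ) := by
  have h1 : hooksMod t μ = ∑ v ∈ μ.cells.filter (fun v => t ∣ hookLength μ v),
      {hookLength μ v} := by
    rw [hooksMod, hooks, Multiset.filter_map, ← Multiset.sum_map_singleton (Multiset.map _ _),
      Multiset.map_map]
    rfl
  rw [h1, ← finsum_mem_coe_finset, mayaHooksMod]
  refine finsum_mem_eq_of_bijOn (fun v => ((μ.rowLen v.1 : ℤ) - v.1 - 1 + c,
    (v.2 : ℤ) - μ.colLen v.2 + c)) ⟨?_, ?_, ?_⟩ ?_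
  · rintro ⟨i, j⟩ hv
    simp only [Finset.coe_filter, YoungDiagram.mem_cells, Set.mem_ofPred_eq] at hv
    have h := hookLength_eq μ hv.1
    have h1 := YoungDiagram.mem_iff_lt_rowLen.1 hv.1
    have h2 := YoungDiagram.mem_iff_lt_colLen.1 hv.1
    refine ⟨⟨⟨i, rfl⟩, notMem_maya.2 ⟨j, rfl⟩, ?_⟩, ?_⟩
    · simp only
      omega
    · simp only [add_sub_add_right_eq_sub]
      rw [← h]
      exact_mod_cast hv.2
  · rintro ⟨i, j⟩ hv ⟨i', j'⟩ hv' h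
    simp only [Prod.mk.injEq] at h
    have h1 := μ.rowLen_anti i i'
    have h2 := μ.rowLen_anti i' i
    have h3 := μ.colLen_anti j j'
    have h4 := μ.colLen_anti j' j
    simp only [Prod.mk.injEq]
    omega
  · rintro ⟨a, b⟩ ⟨⟨⟨i, rfl⟩, hb, hab⟩, hdvd⟩
    obtain ⟨j, rfl⟩ := notMem_maya.1 hb
    simp only at hab hdvd
    have hij : (i, j) ∈ μ := by
      rw [YoungDiagram.mem_iff_lt_rowLen]
      have := lt_rowLen_iff_lt_colLen μ i j
      omega
    refine ⟨(i, j), ?_, rfl⟩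
    simp only [Finset.coe_filter, YoungDiagram.mem_cells, Set.mem_ofPred_eq]
    refine ⟨hij, ?_⟩
    rw [add_sub_add_right_eq_sub, ← hookLength_eq μ hij] at hdvd
    exact_mod_cast hdvd
  · rintro ⟨i, j⟩ hv
    simp only [Finset.coe_filter, YoungDiagram.mem_cells, Set.mem_ofPred_eq] at hv
    have h := hookLength_eq μ hv.1
    simp only [Multiset.singleton_inj]
    omega

theorem hooks_eq_mayaHooks (c : ℤ) (μ : YoungDiagram) : hooks μ = mayaHooks (maya c μ) := by
  rw [← hooksMod_one, ← mayaHooksMod_one, hooksMod_eq_mayaHooksMod 1 c]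

/-! ### Conjugation and residue classes of Maya diagrams -/

/-- The conjugate Maya diagram. -/
def conjMaya (S : Set ℤ) : Set ℤ := {k | -1 - k ∉ S}

theorem maya_transpose (c : ℤ) (μ : YoungDiagram) :
    maya (-c) μ.transpose = conjMaya (maya c μ) := by
  ext k
  simp only [conjMaya, Set.mem_ofPred_eq, notMem_maya]
  simp only [maya, Set.mem_range, YoungDiagram.rowLen_transpose]
  exact exists_congr fun i => by omega

theorem mayaHooks_conjMaya (S : Set ℤ) : mayaHooks (conjMaya S) = mayaHooks S := by
  refine finsum_mem_eq_of_bijOn (fun p => (-1 - p.2, -1 - p.1)) ⟨?_, ?_, ?_⟩ ?_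
  · rintro ⟨a, b⟩ ⟨ha, hb, hab⟩
    simp only [conjMaya, Set.mem_ofPred_eq, not_not] at ha hb hab
    exact ⟨hb, ha, by simp only; omega⟩
  · rintro ⟨a, b⟩ - ⟨a', b'⟩ - h
    simp only [Prod.mk.injEq] at h ⊢
    omega
  · rintro ⟨a, b⟩ ⟨ha, hb, hab⟩
    simp only at ha hb hab
    refine ⟨(-1 - b, -1 - a), ⟨?_, ?_, ?_⟩, by simp⟩
    · simpa [conjMaya] using hb
    · simpa [conjMaya] using ha
    · simp only; omega
  · rintro ⟨a, b⟩ -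
    congr 1
    simp only
    omega

/-- The Maya diagram formed by the elements of `S` congruent to `r` modulo `t`. -/
def residue (t : ℕ) (r : ℤ) (S : Set ℤ) : Set ℤ := {k | t * k + r ∈ S}

/-- An inversion whose difference is divisible by `t` has both ends in one residue class, where
dividing by `t` makes it an inversion of that class. -/
theorem mayaHooksMod_eq_sum {t : ℕ} (ht : 0 < t) {S : Set ℤ} (hS : IsMaya S) :
    mayaHooksMod t S =
      ∑ r ∈ Finset.range t, (mayaHooks (residue t r S)).map (t * ·) := by
  have hfin : ∀ r : ℕ, {p ∈ inversions S | (t : ℤ) ∣ p.1 - p.2 ∧ p.1 % t = r}.Finite :=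
    fun r => hS.finite_inversions.subset fun p hp => hp.1
  have hres : ∀ r ∈ Finset.range t, (mayaHooks (residue t r S)).map (t * ·) =
      ∑ᶠ p ∈ {p ∈ inversions S | (t : ℤ) ∣ p.1 - p.2 ∧ p.1 % t = r}, {(p.1 - p.2).toNat} := by
    intro r hr
    have ht' : (0 : ℤ) < t := by exact_mod_cast ht
    rw [Finset.mem_range] at hr
    have hbij : Set.BijOn (fun p : ℤ × ℤ => ((t : ℤ) * p.1 + r, (t : ℤ) * p.2 + r))
        (inversions (residue t r S))
        {p ∈ inversions S | (t : ℤ) ∣ p.1 - p.2 ∧ p.1 % t = r} := by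
      refine ⟨?_, ?_, ?_⟩
      · rintro ⟨a, b⟩ ⟨ha, hb, hab⟩
        refine ⟨⟨ha, hb, ?_⟩, ⟨a - b, by simp only; ring⟩, ?_⟩
        · simp only at hab ⊢
          have := mul_lt_mul_of_pos_left hab ht'
          omega
        · simp only
          rw [Int.mul_add_emod_self_left]
          exact Int.emod_eq_of_lt (by omega) (by omega)
      · rintro ⟨a, b⟩ - ⟨a', b'⟩ - h
        simp only [Prod.mk.injEq, add_left_inj, mul_eq_mul_left_iff, ht'.ne', or_false] at h ⊢
        exact h
      · rintro ⟨a, b⟩ ⟨⟨ha, hb, hab⟩, hdvd, hmod⟩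
        simp only at ha hb hab hdvd hmod
        have h1 : (t : ℤ) * (a / t) + r = a := by rw [← hmod]; exact Int.mul_ediv_add_emod a t
        have h2 : (t : ℤ) * (b / t) + r = b := by
          rw [← hmod, ← (Int.modEq_iff_dvd.2 hdvd : b % t = a % t)]
          exact Int.mul_ediv_add_emod b t
        refine ⟨(a / t, b / t), ⟨?_, ?_, ?_⟩, ?_⟩
        · simpa [residue, h1] using ha
        · simpa [residue, h2] using hb
        · simp only
          by_contra h
          have := mul_le_mul_of_nonneg_left (not_lt.1 h) ht'.le
          omega
        · simp [h1, h2]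
    have hfin' : (inversions (residue t r S)).Finite :=
      Set.Finite.of_finite_image (by rw [hbij.image_eq]; exact hfin r) hbij.injOn
    rw [mayaHooks, ← Multiset.coe_mapAddMonoidHom, AddMonoidHom.map_finsum_mem _ _ hfin']
    refine finsum_mem_eq_of_bijOn _ hbij ?_
    rintro ⟨a, b⟩ ⟨-, -, hab⟩
    simp only at hab
    simp only [Multiset.coe_mapAddMonoidHom, Multiset.map_singleton, Multiset.singleton_inj]
    rw [show (t : ℤ) * a + r - (t * b + r) = t * (a - b) by ring,
      Int.toNat_mul (by omega) (by omega), Int.toNat_natCast]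
  rw [Finset.sum_congr rfl hres, mayaHooksMod,
    ← finsum_mem_coe_finset, ← finsum_mem_biUnion _ (Finset.finite_toSet _) fun r _ => hfin r]
  · refine finsum_mem_congr ?_ fun _ _ => rfl
    ext p
    have h1 := Int.emod_nonneg p.1 (by omega : (t : ℤ) ≠ 0)
    have h2 := Int.emod_lt_of_pos p.1 (by omega : (0 : ℤ) < t)
    simp only [Set.mem_ofPred_eq, Set.mem_iUnion, Finset.coe_range, Set.mem_Iio, exists_prop]
    constructor
    · rintro ⟨hp, hd⟩
      exact ⟨(p.1 % t).toNat, by omega, hp, hd, by omega⟩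
    · rintro ⟨r, -, hp, hd, -⟩
      exact ⟨hp, hd⟩
  · intro r _ r' _ hne
    rw [Function.onFun, Set.disjoint_left]
    rintro p ⟨-, -, h⟩ ⟨-, -, h'⟩
    exact hne (by exact_mod_cast h.symm.trans h')

/-! ### Regularized sums over Maya diagrams -/

open Classical in
/-- The indicator function of `S` minus that of the negative integers. -/
def excess (S : Set ℤ) (k : ℤ) : ℤ := (if k ∈ S then 1 else 0) - if k < 0 then 1 else 0

/-- The sum of `f` over `S`, regularized by subtracting its sum over the negative integers. -/
def regSum (f : ℤ → ℤ) (S : Set ℤ) : ℤ := ∑ᶠ k, excess S k * f k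

section regSum

variable {S : Set ℤ}

theorem IsMaya.finite_support (hS : IsMaya S) (f : ℤ → ℤ) :
    (Function.support fun k => excess S k * f k).Finite := by
  obtain ⟨N, h1, h2⟩ := hS
  refine (Set.finite_Ico (-N : ℤ) N).subset ?_
  intro k hk
  rw [Function.mem_support] at hk
  rw [Set.mem_Ico]
  by_contra h
  apply hk
  rw [excess]
  by_cases h' : k < -N
  · rw [if_pos (h1 k h'), if_pos (by omega)]; simp
  · rw [if_neg (h2 k (by omega)), if_neg (by omega)]; simp

theorem regSum_add (hS : IsMaya S) (f g : ℤ → ℤ) :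
    regSum (fun k => f k + g k) S = regSum f S + regSum g S := by
  rw [regSum, regSum, regSum, ← finsum_add_distrib (hS.finite_support f) (hS.finite_support g)]
  exact finsum_congr fun k => by ring

theorem regSum_mul (hS : IsMaya S) (a : ℤ) (f : ℤ → ℤ) :
    regSum (fun k => a * f k) S = a * regSum f S := by
  rw [regSum, regSum, mul_finsum' _ _ (hS.finite_support f)]
  exact finsum_congr fun k => by ring

theorem regSum_sub (hS : IsMaya S) (f g : ℤ → ℤ) :
    regSum (fun k => f k - g k) S = regSum f S - regSum g S := by
  have h := regSum_add hS f fun k => -1 * g k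
  rw [regSum_mul hS] at h
  rw [show (fun k => f k - g k) = fun k => f k + -1 * g k by ext; ring, h]
  ring

theorem regSum_affine (hS : IsMaya S) (a d : ℤ) :
    regSum (fun k => a * k + d) S = a * regSum (fun k => k) S + d * regSum (fun _ => 1) S := by
  rw [regSum_add hS, regSum_mul hS a fun k => k]
  congr 1
  simpa using regSum_mul hS d fun _ => 1

/-- The reference set of negative integers does not move with `S`; its shift gains the point `0`,
which accounts for `f 0`. -/
theorem regSum_shift (hS : IsMaya S) (f : ℤ → ℤ) :
    regSum f {k | k - 1 ∈ S} = regSum (fun k => f (k + 1)) S + f 0 := by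
  have h1 : regSum f {k | k - 1 ∈ S} = ∑ᶠ k, excess {k | k - 1 ∈ S} (k + 1) * f (k + 1) :=
    (finsum_comp_equiv (Equiv.addRight (1 : ℤ))).symm
  have h2 : ∀ k, excess {k | k - 1 ∈ S} (k + 1) * f (k + 1) =
      excess S k * f (k + 1) + if k = -1 then f 0 else 0 := by
    intro k
    have h3 : excess {k | k - 1 ∈ S} (k + 1) = excess S k + if k = -1 then 1 else 0 := by
      have hk : k + 1 ∈ {k | k - 1 ∈ S} ↔ k ∈ S := by simp
      rw [excess, excess]
      by_cases h : k ∈ S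
      · rw [if_pos h, if_pos (hk.2 h)]
        split_ifs <;> omega
      · rw [if_neg h, if_neg (hk.not.2 h)]
        split_ifs <;> omega
    rw [h3, add_mul]
    split_ifs with h
    · simp [h]
    · simp
  rw [h1, finsum_congr h2, finsum_add_distrib (hS.finite_support _)
    ((Set.finite_singleton (-1 : ℤ)).subset fun k => by simp +contextual)]
  rw [finsum_eq_single (fun k : ℤ => if k = -1 then f 0 else 0) (-1) (by simp +contextual)]
  rfl

theorem regSum_conjMaya (f : ℤ → ℤ) :
    regSum f (conjMaya S) = -regSum (fun k => f (-1 - k)) S := by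
  rw [regSum, regSum, ← finsum_neg_distrib, ← finsum_comp_equiv (Equiv.subLeft (-1 : ℤ))]
  refine finsum_congr fun k => ?_
  rw [← neg_mul, Equiv.subLeft_apply]
  congr 1
  have hk : -1 - k ∈ conjMaya S ↔ k ∉ S := by simp [conjMaya]
  rw [excess, excess]
  by_cases h : k ∈ S
  · rw [if_pos h, if_neg (hk.not.2 (not_not.2 h))]
    split_ifs <;> omega
  · rw [if_neg h, if_pos (hk.2 h)]
    split_ifs <;> omega

theorem IsMaya.residue (hS : IsMaya S) {t : ℕ} (ht : 0 < t) (r : ℤ) :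
    IsMaya (residue t r S) := by
  obtain ⟨N, h1, h2⟩ := hS
  have ht' : (1 : ℤ) ≤ t := by exact_mod_cast ht
  refine ⟨N + r.natAbs, fun k hk => h1 _ ?_, fun k hk => h2 _ ?_⟩
  · rw [Nat.cast_add] at hk
    have : (t : ℤ) * k ≤ 1 * k := mul_le_mul_of_nonpos_right ht' (by omega)
    omega
  · rw [Nat.cast_add] at hk
    have : (1 : ℤ) * k ≤ t * k := mul_le_mul_of_nonneg_right ht' (by omega)
    omega

theorem regSum_eq_sum_residue (hS : IsMaya S) {t : ℕ} (ht : 0 < t) (f : ℤ → ℤ) :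
    regSum f S = ∑ r ∈ Finset.range t, regSum (fun k => f (t * k + r)) (residue t r S) := by
  have ht' : (0 : ℤ) < t := by exact_mod_cast ht
  have hres : ∀ r ∈ Finset.range t, regSum (fun k => f (t * k + r)) (residue t r S) =
      ∑ᶠ k ∈ {k : ℤ | k % t = r} ∩ Function.support fun k => excess S k * f k,
        excess S k * f k := by
    intro r hr
    rw [Finset.mem_range] at hr
    rw [finsum_mem_inter_support, regSum, ← finsum_mem_univ]
    refine finsum_mem_eq_of_bijOn (fun k => (t : ℤ) * k + r) ⟨?_, ?_, ?_⟩ ?_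
    · intro k _
      simp only [Set.mem_ofPred_eq, Int.mul_add_emod_self_left]
      exact Int.emod_eq_of_lt (by omega) (by omega)
    · intro k _ l _ h
      simpa [ht.ne'] using h
    · intro k hk
      refine ⟨k / t, trivial, ?_⟩
      rw [Set.mem_ofPred_eq] at hk
      simp only [← hk]
      exact Int.mul_ediv_add_emod k t
    · intro k _
      congr 1
      -- Because `0 ≤ r < t`, the reference set of negative integers restricts to itself in each
      -- residue class.
      have h : (t : ℤ) * k + r < 0 ↔ k < 0 := by
        constructor
        · intro h
          by_contra h'
          have := mul_nonneg ht'.le (not_lt.1 h')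
          omega
        · intro h
          have : (t : ℤ) * k ≤ t * (-1) := mul_le_mul_of_nonneg_left (by omega) ht'.le
          omega
      simp only [excess, h]
      rfl
  rw [Finset.sum_congr rfl hres, ← finsum_mem_coe_finset,
    ← finsum_mem_biUnion _ (Finset.finite_toSet _) fun r _ =>
      (hS.finite_support f).subset Set.inter_subset_right]
  · rw [← Set.iUnion₂_inter, finsum_mem_inter_support, regSum, ← finsum_mem_univ]
    refine finsum_mem_congr ?_ fun _ _ => rfl
    ext k
    have h1 := Int.emod_nonneg k ht'.ne'
    have h2 := Int.emod_lt_of_pos k ht'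
    simp only [Set.mem_univ, Finset.coe_range, Set.mem_Iio, Set.mem_iUnion, true_iff,
      Set.mem_ofPred_eq, exists_prop]
    exact ⟨(k % t).toNat, by omega, by omega⟩
  · intro r _ r' _ hne
    rw [Function.onFun, Set.disjoint_left]
    rintro k ⟨h, -⟩ ⟨h', -⟩
    simp only [Set.mem_ofPred_eq] at h h'
    exact hne (by exact_mod_cast h.symm.trans h')

theorem sum_range_mul_two {M : Type*} [AddCommMonoid M] (m : ℕ) (f : ℕ → M) :
    ∑ r ∈ Finset.range (2 * m), f r = ∑ r ∈ Finset.range m, (f r + f (2 * m - 1 - r)) := by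
  rw [two_mul, Finset.sum_range_add, Finset.sum_add_distrib]
  congr 1
  rw [← Finset.sum_range_reflect]
  refine Finset.sum_congr rfl fun r hr => ?_
  rw [Finset.mem_range] at hr
  congr 1
  omega

theorem residue_reflect (hc : conjMaya S = S) (t : ℕ) (r : ℤ) :
    residue t (t - 1 - r) S = conjMaya (residue t r S) := by
  ext k
  simp only [residue, conjMaya, Set.mem_ofPred_eq]
  conv_lhs => rw [← hc]
  simp only [conjMaya, Set.mem_ofPred_eq]
  rw [show -1 - ((t : ℤ) * k + (t - 1 - r)) = t * (-1 - k) + r by ring]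

theorem regSum_eq_of_conjMaya_eq (hS : IsMaya S) (hc : conjMaya S = S) {m : ℕ} (hm : 0 < m)
    (f : ℤ → ℤ) :
    regSum f S = ∑ r ∈ Finset.range m,
      regSum (fun k => f ((2 * m : ℕ) * k + r) - f (-1 - ((2 * m : ℕ) * k + r)))
        (residue (2 * m) r S) := by
  rw [regSum_eq_sum_residue hS (t := 2 * m) (by omega), sum_range_mul_two]
  refine Finset.sum_congr rfl fun r hr => ?_
  rw [Finset.mem_range] at hr
  rw [regSum_sub (hS.residue (by omega) r), sub_eq_add_neg]
  congr 1
  rw [show ((2 * m - 1 - r : ℕ) : ℤ) = (2 * m : ℕ) - 1 - (r : ℤ) by omega, residue_reflect hc,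
    regSum_conjMaya]
  congr 2
  ext k
  congr 1
  ring

theorem mayaHooksMod_eq_of_conjMaya_eq (hS : IsMaya S) (hc : conjMaya S = S) {m : ℕ}
    (hm : 0 < m) : mayaHooksMod (2 * m) S =
      ∑ r ∈ Finset.range m, 2 • (mayaHooks (residue (2 * m) r S)).map (2 * m * ·) := by
  rw [mayaHooksMod_eq_sum (by omega) hS, sum_range_mul_two]
  refine Finset.sum_congr rfl fun r hr => ?_
  rw [Finset.mem_range] at hr
  rw [show ((2 * m - 1 - r : ℕ) : ℤ) = (2 * m : ℕ) - 1 - (r : ℤ) by omega, residue_reflect hc,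
    mayaHooks_conjMaya, two_nsmul]

end regSum

/-! ### Regularized sums for partitions -/

theorem sum_cells {M : Type*} [AddCommMonoid M] (μ : YoungDiagram) (F : ℕ × ℕ → M) :
    ∑ v ∈ μ.cells, F v =
      ∑ i ∈ Finset.range (μ.colLen 0), ∑ j ∈ Finset.range (μ.rowLen i), F (i, j) := by
  refine Finset.sum_finset_product _ _ _ ?_
  rintro ⟨i, j⟩
  have h1 := lt_rowLen_iff_lt_colLen μ i 0
  simp only [YoungDiagram.mem_cells, Finset.mem_range, YoungDiagram.mem_iff_lt_rowLen]
  omega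

/-- Row `i` moves the element `-1 - i` of the empty diagram to `λ_i - i - 1`; the change of `f`
telescopes over the boxes of the row. -/
theorem regSum_maya_zero (μ : YoungDiagram) (f : ℤ → ℤ) :
    regSum f (maya 0 μ) = ∑ v ∈ μ.cells, (f (v.2 - v.1) - f (v.2 - v.1 - 1)) := by
  classical
  have h1 : ∀ i : ℕ, ∑ j ∈ Finset.range (μ.rowLen i), (f ((j : ℤ) - i) - f (j - i - 1)) =
      f (μ.rowLen i - i - 1) - f (-1 - i) := by
    intro i
    have := Finset.sum_range_sub (fun j : ℕ => f ((j : ℤ) - i - 1)) (μ.rowLen i)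
    simp only [Nat.cast_add, Nat.cast_one, Nat.cast_zero] at this
    rw [show (-1 - i : ℤ) = 0 - i - 1 by ring, ← this]
    exact Finset.sum_congr rfl fun j _ => by
      rw [show (j : ℤ) + 1 - i - 1 = j - i by ring]
  rw [sum_cells, Finset.sum_congr rfl fun i _ => h1 i, Finset.sum_sub_distrib, regSum]
  have hsupp : (Function.support fun k => excess (maya 0 μ) k * f k) ⊆
      ↑(Finset.Ico (-(μ.colLen 0) : ℤ) (μ.rowLen 0)) := by
    intro k hk
    rw [Function.mem_support] at hk
    rw [Finset.coe_Ico, Set.mem_Ico]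
    by_contra h
    apply hk
    rw [excess]
    by_cases h' : k < -(μ.colLen 0 : ℤ)
    · have hmem : k ∈ maya 0 μ := by
        by_contra hn
        obtain ⟨j, hj⟩ := notMem_maya.1 hn
        have := μ.colLen_anti 0 j (Nat.zero_le _)
        omega
      rw [if_pos hmem, if_pos (by omega)]; simp
    · have hmem : k ∉ maya 0 μ := by
        rintro ⟨i, hi⟩
        have := μ.rowLen_anti 0 i (Nat.zero_le _)
        simp only at hi
        omega
      rw [if_neg hmem, if_neg (by omega)]; simp
  rw [finsum_eq_sum_of_support_subset _ hsupp]
  simp only [excess, sub_mul, ite_mul, one_mul, zero_mul, Finset.sum_sub_distrib,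
    ← Finset.sum_filter]
  congr 1
  · symm
    refine Finset.sum_bij (fun i _ => (μ.rowLen i : ℤ) - i - 1) ?_ ?_ ?_ fun _ _ => rfl
    · intro i hi
      rw [Finset.mem_range] at hi
      have := μ.rowLen_anti 0 i (Nat.zero_le _)
      simp only [Finset.mem_filter, Finset.mem_Ico]
      exact ⟨by omega, i, by simp⟩
    · intro i _ i' _ h
      have h1 := μ.rowLen_anti i i'
      have h2 := μ.rowLen_anti i' i
      omega
    · intro k hk
      simp only [Finset.mem_filter, Finset.mem_Ico] at hk
      obtain ⟨⟨hk1, hk2⟩, i, hi⟩ := hk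
      simp only at hi
      refine ⟨i, ?_, by omega⟩
      have := lt_rowLen_iff_lt_colLen μ i 0
      rw [Finset.mem_range]
      omega
  · symm
    refine Finset.sum_bij (fun i _ => -1 - (i : ℤ)) ?_ ?_ ?_ fun _ _ => rfl
    · intro i hi
      rw [Finset.mem_range] at hi
      simp only [Finset.mem_filter, Finset.mem_Ico]
      omega
    · intro i _ i' _ h
      omega
    · intro k hk
      simp only [Finset.mem_filter, Finset.mem_Ico] at hk
      exact ⟨(-1 - k).toNat, by rw [Finset.mem_range]; omega, by omega⟩

theorem maya_add_one (c : ℤ) (μ : YoungDiagram) : maya (c + 1) μ = {k | k - 1 ∈ maya c μ} := by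
  ext k
  simp only [maya, Set.mem_range, Set.mem_ofPred_eq]
  exact exists_congr fun i => by omega

theorem regSum_one_maya (c : ℤ) (μ : YoungDiagram) : regSum (fun _ => 1) (maya c μ) = c := by
  have h0 : regSum (fun _ => 1) (maya 0 μ) = 0 := by simp [regSum_maya_zero]
  have hstep : ∀ c, regSum (fun _ => 1) (maya (c + 1) μ) = regSum (fun _ => 1) (maya c μ) + 1 :=
    fun c => by rw [maya_add_one, regSum_shift (isMaya_maya c μ)]
  induction c using Int.induction_on with
  | zero => exact h0
  | succ c ih => rw [hstep, ih]
  | pred c ih =>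
    have := hstep (-c - 1)
    rw [sub_add_cancel, ih] at this
    omega

/-- Raising the charge from `c` to `c + 1` shifts all elements by one and so adds the regularized
count `c`. Doubling avoids halving `c * (c - 1)`. -/
theorem regSum_id_maya (c : ℤ) (μ : YoungDiagram) :
    2 * regSum (fun k => k) (maya c μ) = 2 * μ.card + c * (c - 1) := by
  have h0 : regSum (fun k => k) (maya 0 μ) = μ.card := by simp [regSum_maya_zero]
  have hstep : ∀ c, regSum (fun k => k) (maya (c + 1) μ) =
      regSum (fun k => k) (maya c μ) + c := fun c => by
    rw [maya_add_one, regSum_shift (isMaya_maya c μ)]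
    have := regSum_affine (isMaya_maya c μ) 1 1
    simp only [one_mul, regSum_one_maya] at this
    rw [this, add_zero]
  induction c using Int.induction_on with
  | zero => rw [h0]; ring
  | succ c ih => rw [hstep, mul_add, ih]; ring
  | pred c ih =>
    have := hstep (-c - 1)
    rw [sub_add_cancel] at this
    rw [this] at ih
    linear_combination ih

theorem card_eq_regSum (μ : YoungDiagram) :
    (μ.card : ℤ) = regSum (fun k => k + 1) (maya 0 μ) := by
  simp [regSum_maya_zero]

theorem bgRank_eq_regSum (μ : YoungDiagram) :
    bgRank μ = regSum (fun k => if Even k then 1 else 0) (maya 0 μ) := by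
  rw [regSum_maya_zero, bgRank]
  refine Finset.sum_congr rfl fun v _ => ?_
  have h1 : Even ((v.2 : ℤ) - v.1) ↔ Even (v.1 + v.2) := by
    rw [Int.even_sub, Nat.even_add, Int.even_coe_nat, Int.even_coe_nat]; tauto
  have h2 : Even ((v.2 : ℤ) - v.1 - 1) ↔ ¬ Even (v.1 + v.2) := by
    rw [← h1, Int.even_sub_one]
  rw [neg_one_pow_eq_ite]
  simp only [h1, h2]
  split_ifs <;> simp_all

/-! ### Self-conjugate partitions and their Maya diagrams -/

theorem conjMaya_conjMaya (S : Set ℤ) : conjMaya (conjMaya S) = S := by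
  ext k
  simp [conjMaya]

theorem IsMaya.conjMaya {S : Set ℤ} (hS : IsMaya S) : IsMaya (conjMaya S) := by
  obtain ⟨N, h1, h2⟩ := hS
  refine ⟨N, fun k hk => h2 _ (by omega), fun k hk h => h (h1 _ (by omega))⟩

theorem maya_injective : Function.Injective fun p : ℤ × YoungDiagram => maya p.1 p.2 := by
  rintro ⟨c, μ⟩ ⟨d, ν⟩ h
  simp only at h
  have hc : c = d := by
    rw [← regSum_one_maya c μ, h, regSum_one_maya]
  subst hc
  rw [maya_injective_of_charge h]

theorem conjMaya_maya_of_mem_SC {μ : YoungDiagram} (hμ : μ ∈ SC) :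
    conjMaya (maya 0 μ) = maya 0 μ := by
  rw [← maya_transpose, neg_zero, show μ.transpose = μ from hμ]

theorem exists_mem_SC_maya_eq {S : Set ℤ} (hS : IsMaya S) (hc : conjMaya S = S) :
    ∃ μ ∈ SC, maya 0 μ = S := by
  obtain ⟨c, μ, rfl⟩ := exists_maya_eq hS
  rw [← maya_transpose] at hc
  have h := @maya_injective (-c, μ.transpose) (c, μ) hc
  -- Conjugation negates the charge, so invariance forces `c = 0`.
  simp only [Prod.mk.injEq] at h
  obtain rfl : c = 0 := by omega
  exact ⟨μ, h.2, rfl⟩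

/-- Partitions together with a charge correspond to Maya diagrams. -/
def mayaEquiv : ℤ × YoungDiagram ≃ {S : Set ℤ // IsMaya S} :=
  Equiv.ofBijective (fun p => ⟨maya p.1 p.2, isMaya_maya p.1 p.2⟩)
    ⟨fun _ _ h => maya_injective (congrArg Subtype.val h), fun S => by
      obtain ⟨c, μ, h⟩ := exists_maya_eq S.2
      exact ⟨(c, μ), Subtype.ext h⟩⟩

theorem maya_mayaEquiv_symm (S : {S : Set ℤ // IsMaya S}) :
    maya (mayaEquiv.symm S).1 (mayaEquiv.symm S).2 = S.1 :=
  congrArg Subtype.val (mayaEquiv.apply_symm_apply S)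

/-- The set of integers whose elements congruent to `r` modulo `t` are given by `T r`. -/
def ofResidues (t : ℕ) (T : ℤ → Set ℤ) : Set ℤ := {n | n / t ∈ T (n % t)}

theorem mul_add_mem_ofResidues {t : ℕ} {T : ℤ → Set ℤ} {r : ℤ} (h0 : 0 ≤ r) (h1 : r < t)
    (k : ℤ) : t * k + r ∈ ofResidues t T ↔ k ∈ T r := by
  rw [ofResidues, Set.mem_ofPred_eq, Int.mul_add_emod_self_left, Int.emod_eq_of_lt h0 h1,
    Int.mul_add_ediv_left _ _ (by omega), Int.ediv_eq_zero_of_lt h0 h1, add_zero]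

theorem residue_ofResidues {t : ℕ} {T : ℤ → Set ℤ} {r : ℤ} (h0 : 0 ≤ r) (h1 : r < t) :
    residue t r (ofResidues t T) = T r := by
  ext k
  exact mul_add_mem_ofResidues h0 h1 k

theorem isMaya_ofResidues {t : ℕ} (ht : 0 < t) {T : ℤ → Set ℤ}
    (hT : ∀ r, IsMaya (T r)) : IsMaya (ofResidues t T) := by
  choose N h1 h2 using hT
  have ht' : (0 : ℤ) < t := by exact_mod_cast ht
  let M := (Finset.range t).sup fun r => N r
  have hM : ∀ n : ℤ, N (n % t) ≤ M := by
    intro n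
    have h1 := Int.emod_nonneg n ht'.ne'
    have h2 := Int.emod_lt_of_pos n ht'
    obtain ⟨r, hr⟩ := Int.eq_ofNat_of_zero_le h1
    rw [hr] at h2 ⊢
    exact Finset.le_sup (f := fun r : ℕ => N r) (Finset.mem_range.2 (by exact_mod_cast h2))
  refine ⟨t * M, fun n hn => h1 _ _ ?_, fun n hn => h2 _ _ ?_⟩
  · have : n / t < -M := Int.ediv_lt_of_lt_mul ht' (by push_cast at hn; linarith)
    have := hM n
    omega
  · have : (M : ℤ) ≤ n / t := Int.le_ediv_of_mul_le ht' (by push_cast at hn; linarith)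
    have := hM n
    omega

theorem conjMaya_ofResidues {t : ℕ} (ht : 0 < t) {T : ℤ → Set ℤ}
    (hT : ∀ r : ℤ, 0 ≤ r → r < t → T (t - 1 - r) = conjMaya (T r)) :
    conjMaya (ofResidues t T) = ofResidues t T := by
  ext n
  have h1 := Int.emod_nonneg n (by omega : (t : ℤ) ≠ 0)
  have h2 := Int.emod_lt_of_pos n (by omega : (0 : ℤ) < t)
  obtain ⟨q, r, hr0, hrt, rfl⟩ : ∃ q r : ℤ, 0 ≤ r ∧ r < t ∧ n = t * q + r :=
    ⟨n / t, n % t, h1, h2, (Int.mul_ediv_add_emod n t).symm⟩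
  rw [mul_add_mem_ofResidues hr0 hrt, conjMaya, Set.mem_ofPred_eq,
    show -1 - ((t : ℤ) * q + r) = t * (-1 - q) + (t - 1 - r) by ring,
    mul_add_mem_ofResidues (by omega) (by omega), hT r hr0 hrt, conjMaya, Set.mem_ofPred_eq,
    not_not, sub_sub_cancel]

theorem eq_of_residue_eq {m : ℕ} (hm : 0 < m) {S S' : Set ℤ} (hc : conjMaya S = S)
    (hc' : conjMaya S' = S')
    (h : ∀ r : ℕ, r < m → residue (2 * m) r S = residue (2 * m) r S') : S = S' := by
  have hall : ∀ r : ℤ, 0 ≤ r → r < (2 * m : ℕ) → residue (2 * m) r S = residue (2 * m) r S' := by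
    intro r h0 h1
    by_cases hr : r < m
    · have := h r.toNat (by omega)
      rwa [Int.toNat_of_nonneg h0] at this
    · have := h (2 * m - 1 - r).toNat (by omega)
      rw [Int.toNat_of_nonneg (by omega)] at this
      rw [show r = (2 * m : ℕ) - 1 - (2 * m - 1 - r) by push_cast; ring, residue_reflect hc,
        residue_reflect hc', this]
  ext n
  have h1 := Int.emod_nonneg n (by omega : ((2 * m : ℕ) : ℤ) ≠ 0)
  have h2 := Int.emod_lt_of_pos n (by omega : (0 : ℤ) < (2 * m : ℕ))
  have h3 : n / (2 * m : ℕ) ∈ residue (2 * m) (n % (2 * m : ℕ)) S ↔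
    n / (2 * m : ℕ) ∈ residue (2 * m) (n % (2 * m : ℕ)) S' := by rw [hall _ h1 h2]
  simpa only [residue, Set.mem_ofPred_eq, Int.mul_ediv_add_emod] using h3

/-! ### The charged quotient of a self-conjugate partition -/

/-- The `2 * m`-quotients and charges of a self-conjugate partition for the residues below `m`,
which determine it. -/
def chargedQuotient {m : ℕ} (hm : 0 < m) (μ : SC) (r : Fin m) : ℤ × YoungDiagram :=
  mayaEquiv.symm ⟨residue (2 * m) (r : ℕ) (maya 0 μ.1),
    (isMaya_maya 0 μ.1).residue (by omega) _⟩

theorem maya_chargedQuotient {m : ℕ} (hm : 0 < m) (μ : SC) (r : Fin m) :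
    maya (chargedQuotient hm μ r).1 (chargedQuotient hm μ r).2 =
      residue (2 * m) (r : ℕ) (maya 0 μ.1) :=
  maya_mayaEquiv_symm _

theorem chargedQuotient_injective {m : ℕ} (hm : 0 < m) :
    Function.Injective (chargedQuotient hm) := by
  intro μ ν h
  have h' : maya 0 μ.1 = maya 0 ν.1 := by
    refine eq_of_residue_eq hm (conjMaya_maya_of_mem_SC μ.2) (conjMaya_maya_of_mem_SC ν.2) ?_
    intro r hr
    rw [← maya_chargedQuotient hm μ ⟨r, hr⟩, ← maya_chargedQuotient hm ν ⟨r, hr⟩, h]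
  exact Subtype.ext (maya_injective_of_charge h')

theorem chargedQuotient_surjective {m : ℕ} (hm : 0 < m) :
    Function.Surjective (chargedQuotient hm) := by
  intro v
  let f : Fin m → Set ℤ := fun r => maya (v r).1 (v r).2
  let z : Fin m := ⟨0, hm⟩
  -- Residues below `m` are prescribed and the others are forced by reflection. The last branch is
  -- never reached.
  let T : ℤ → Set ℤ := fun r =>
    if h : r.toNat < m then f ⟨r.toNat, h⟩
    else if h : (2 * m - 1 - r).toNat < m then conjMaya (f ⟨(2 * m - 1 - r).toNat, h⟩) else f z
  have hf : ∀ r, IsMaya (f r) := fun r => isMaya_maya _ _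
  have hmaya : IsMaya (ofResidues (2 * m) T) := by
    refine isMaya_ofResidues (by omega) fun r => ?_
    simp only [T]
    split_ifs
    · exact hf _
    · exact (hf _).conjMaya
    · exact hf _
  have hconj : conjMaya (ofResidues (2 * m) T) = ofResidues (2 * m) T := by
    refine conjMaya_ofResidues (by omega) fun r h0 h1 => ?_
    have hcast : ((2 * m : ℕ) : ℤ) - 1 - r = 2 * m - 1 - r := by push_cast; ring
    rw [hcast]
    by_cases h : r.toNat < m
    · have h' : ¬ (2 * m - 1 - r).toNat < m := by omega
      simp only [T, dif_pos h, dif_neg h', sub_sub_cancel]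
    · have h' : (2 * m - 1 - r).toNat < m := by omega
      simp only [T, dif_pos h', dif_neg h, conjMaya_conjMaya]
  obtain ⟨μ, hμ, h⟩ := exists_mem_SC_maya_eq hmaya hconj
  refine ⟨⟨μ, hμ⟩, funext fun r => maya_injective ?_⟩
  simp only
  rw [maya_chargedQuotient, h, residue_ofResidues (by omega) (by omega)]
  simp [T, f]

/-- The bijection from self-conjugate partitions to families of charged partitions. -/
def chargedQuotientEquiv {m : ℕ} (hm : 0 < m) : SC ≃ (Fin m → ℤ × YoungDiagram) :=
  Equiv.ofBijective _ ⟨chargedQuotient_injective hm, chargedQuotient_surjective hm⟩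

/-- The size of the contribution of the charge `c` in residue class `r` modulo `2 * m`. -/
def coreSize (m r : ℕ) (c : ℤ) : ℕ := (2 * m * (c * (c - 1)) + (2 * r + 1) * c).toNat

/-- This bound serves twice: `toNat` in `coreSize` loses nothing, and each size is attained by
finitely many charges. -/
theorem natAbs_le_coreSize {m r : ℕ} (hr : r < m) (c : ℤ) :
    (c.natAbs : ℤ) ≤ 2 * m * (c * (c - 1)) + (2 * r + 1) * c := by
  have hr' : (r : ℤ) + 1 ≤ m := by exact_mod_cast hr
  have hr0 : (0 : ℤ) ≤ r := by positivity
  rcases le_or_gt c 0 with h | h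
  · rw [Int.ofNat_natAbs_of_nonpos h]
    nlinarith [mul_nonneg (mul_self_nonneg c) (by omega : (0 : ℤ) ≤ m),
      mul_nonneg (neg_nonneg.2 h) (by omega : (0 : ℤ) ≤ m - (r + 1))]
  · rw [Int.natAbs_of_nonneg h.le]
    nlinarith [mul_nonneg (mul_nonneg h.le (by omega : (0 : ℤ) ≤ c - 1))
      (by omega : (0 : ℤ) ≤ m), mul_nonneg h.le hr0]

theorem finiteFibres_coreSize {m r : ℕ} (hr : r < m) : FiniteFibres (coreSize m r) := by
  intro n
  refine (Set.finite_Icc (-n : ℤ) n).subset ?_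
  intro c hc
  have := natAbs_le_coreSize hr c
  simp only [Set.mem_ofPred_eq, coreSize] at hc
  rw [Set.mem_Icc]
  omega

theorem card_eq_sum {m : ℕ} (hm : 0 < m) (μ : SC) :
    μ.1.card = ∑ r : Fin m, (coreSize m r (chargedQuotientEquiv hm μ r).1 +
      4 * m * (chargedQuotientEquiv hm μ r).2.card) := by
  zify
  rw [card_eq_regSum, regSum_eq_of_conjMaya_eq (isMaya_maya 0 μ.1)
    (conjMaya_maya_of_mem_SC μ.2) hm, Finset.sum_range]
  refine Finset.sum_congr rfl fun r _ => ?_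
  rw [← maya_chargedQuotient hm μ r]
  change _ = ((coreSize m r (chargedQuotient hm μ r).1 : ℤ) + 4 * m *
    ((chargedQuotient hm μ r).2.card : ℤ))
  generalize chargedQuotient hm μ r = p
  have h1 := regSum_affine (isMaya_maya p.1 p.2) (4 * m) (2 * r + 1)
  have h2 := regSum_id_maya p.1 p.2
  rw [regSum_one_maya] at h1
  have h3 := natAbs_le_coreSize r.2 p.1
  rw [coreSize, Int.toNat_of_nonneg (by omega)]
  -- For `n = 2mk + r` the paired terms give `(n + 1) - (-n) = 4mk + 2r + 1`, affine in `k`; its sum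
  -- involves only the charge and the size of the quotient.
  rw [show (fun k : ℤ => ((2 * m : ℕ) * k + (r : ℕ) + 1) -
      (-1 - ((2 * m : ℕ) * k + (r : ℕ)) + 1)) =
    fun k : ℤ => (4 * m) * k + (2 * (r : ℕ) + 1) by ext k; push_cast; ring, h1]
  linear_combination (2 * m : ℤ) * h2

theorem bgRank_eq_sum {m : ℕ} (hm : 0 < m) (μ : SC) :
    bgRank μ.1 = ∑ r : Fin m, (-1) ^ (r : ℕ) * (chargedQuotientEquiv hm μ r).1 := by
  rw [bgRank_eq_regSum, regSum_eq_of_conjMaya_eq (isMaya_maya 0 μ.1)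
    (conjMaya_maya_of_mem_SC μ.2) hm, Finset.sum_range]
  refine Finset.sum_congr rfl fun r _ => ?_
  rw [← maya_chargedQuotient hm μ r]
  change _ = (-1) ^ (r : ℕ) * (chargedQuotient hm μ r).1
  generalize chargedQuotient hm μ r = p
  have h1 := regSum_mul (isMaya_maya p.1 p.2) ((-1) ^ (r : ℕ)) fun _ => 1
  rw [regSum_one_maya] at h1
  rw [← h1]
  congr 1
  ext k
  -- Since `2m` is even, parity depends on `r` only, and exactly one of `n`, `-1 - n` is even: the
  -- summand is the constant `(-1)^r`.
  have h2 : Even (((2 * m : ℕ) : ℤ) * k + (r : ℕ)) ↔ Even (r : ℕ) := by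
    rw [Int.even_add, Int.even_mul, Int.even_coe_nat, Int.even_coe_nat]; simp
  have h3 : Even (-1 - (((2 * m : ℕ) : ℤ) * k + (r : ℕ))) ↔ ¬ Even (r : ℕ) := by
    rw [Int.even_sub, h2]; simp
  rw [neg_one_pow_eq_ite]
  simp only [h2, h3]
  split_ifs <;> simp_all

theorem hooksMod_eq_sum {m : ℕ} (hm : 0 < m) (μ : SC) :
    hooksMod (2 * m) μ.1 = ∑ r : Fin m,
      2 • (hooks (chargedQuotientEquiv hm μ r).2).map (2 * m * ·) := by
  rw [hooksMod_eq_mayaHooksMod _ 0, mayaHooksMod_eq_of_conjMaya_eq (isMaya_maya 0 μ.1)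
    (conjMaya_maya_of_mem_SC μ.2) hm, Finset.sum_range]
  refine Finset.sum_congr rfl fun r _ => ?_
  rw [← maya_chargedQuotient hm μ r, ← hooks_eq_mayaHooks]
  rfl

/-! ### Self-conjugate partitions and sets of natural numbers -/

/-- The Maya diagram with a given set of nonnegative elements that is its own conjugate. -/
def selfConjMaya (A : Finset ℕ) : Set ℤ :=
  {n | if 0 ≤ n then n.toNat ∈ A else (-1 - n).toNat ∉ A}

theorem isMaya_selfConjMaya (A : Finset ℕ) : IsMaya (selfConjMaya A) := by
  refine ⟨A.sup id + 1, fun n hn => ?_, fun n hn h => ?_⟩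
  · rw [selfConjMaya, Set.mem_ofPred_eq, if_neg (by omega)]
    intro h
    have := Finset.le_sup (f := id) h
    simp only [id] at this
    omega
  · rw [selfConjMaya, Set.mem_ofPred_eq, if_pos (by omega)] at h
    have := Finset.le_sup (f := id) h
    simp only [id] at this
    omega

theorem conjMaya_selfConjMaya (A : Finset ℕ) : conjMaya (selfConjMaya A) = selfConjMaya A := by
  ext n
  rw [conjMaya, Set.mem_ofPred_eq, selfConjMaya, Set.mem_ofPred_eq, Set.mem_ofPred_eq]
  by_cases h : 0 ≤ n
  · rw [if_neg (by omega), if_pos h, not_not, sub_sub_cancel]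
  · rw [if_pos (by omega), if_neg h]

theorem natCast_mem_selfConjMaya (A : Finset ℕ) (k : ℕ) : (k : ℤ) ∈ selfConjMaya A ↔ k ∈ A := by
  simp [selfConjMaya]

theorem selfConjMaya_injective : Function.Injective selfConjMaya := by
  intro A B h
  ext k
  rw [← natCast_mem_selfConjMaya, h, natCast_mem_selfConjMaya]

theorem exists_selfConjMaya_eq {S : Set ℤ} (hS : IsMaya S) (hc : conjMaya S = S) :
    ∃ A, selfConjMaya A = S := by
  have hfin : {k : ℕ | (k : ℤ) ∈ S}.Finite := by
    refine ((hS.finite_inter_Ici 0).preimage Nat.cast_injective.injOn).subset ?_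
    intro k hk
    exact ⟨hk, by simp⟩
  refine ⟨hfin.toFinset, ?_⟩
  ext n
  rw [selfConjMaya, Set.mem_ofPred_eq]
  by_cases h : 0 ≤ n
  · rw [if_pos h, Set.Finite.mem_toFinset, Set.mem_ofPred_eq, Int.toNat_of_nonneg h]
  · rw [if_neg h, Set.Finite.mem_toFinset, Set.mem_ofPred_eq, Int.toNat_of_nonneg (by omega)]
    conv_rhs => rw [← hc]
    rfl

/-- The self-conjugate partition whose Maya diagram has `A` as its set of nonnegative elements. -/
def diagonalPartition (A : Finset ℕ) : SC :=
  ⟨_, (exists_mem_SC_maya_eq (isMaya_selfConjMaya A) (conjMaya_selfConjMaya A)).choose_spec.1⟩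

theorem maya_diagonalPartition (A : Finset ℕ) :
    maya 0 (diagonalPartition A).1 = selfConjMaya A :=
  (exists_mem_SC_maya_eq (isMaya_selfConjMaya A) (conjMaya_selfConjMaya A)).choose_spec.2

/-- The bijection from finite sets of natural numbers to self-conjugate partitions. -/
def diagonalEquiv : Finset ℕ ≃ SC :=
  Equiv.ofBijective diagonalPartition
    ⟨fun A B h => selfConjMaya_injective (by
      rw [← maya_diagonalPartition, h, maya_diagonalPartition]), fun μ => by
      obtain ⟨A, hA⟩ := exists_selfConjMaya_eq (isMaya_maya 0 μ.1) (conjMaya_maya_of_mem_SC μ.2)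
      refine ⟨A, Subtype.ext (maya_injective_of_charge (c := 0) ?_)⟩
      rw [maya_diagonalPartition, hA]⟩

theorem regSum_selfConjMaya (f : ℤ → ℤ) (A : Finset ℕ) :
    regSum f (selfConjMaya A) = ∑ k ∈ A, (f k - f (-1 - k)) := by
  have hex : ∀ n : ℤ, excess (selfConjMaya A) n =
      if 0 ≤ n then (if n.toNat ∈ A then 1 else 0) else if (-1 - n).toNat ∈ A then -1 else 0 := by
    intro n
    have hn : n ∈ selfConjMaya A ↔ if 0 ≤ n then n.toNat ∈ A else (-1 - n).toNat ∉ A := Iff.rfl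
    rw [excess]
    by_cases h : 0 ≤ n
    · rw [if_pos h] at hn
      by_cases h' : n.toNat ∈ A
      · rw [if_pos (hn.2 h'), if_pos h, if_pos h', if_neg (by omega), sub_zero]
      · rw [if_neg (hn.not.2 h'), if_pos h, if_neg h', if_neg (by omega), sub_zero]
    · rw [if_neg h] at hn
      by_cases h' : (-1 - n).toNat ∈ A
      · rw [if_neg (hn.not.2 (not_not.2 h')), if_neg h, if_pos h', if_pos (by omega), zero_sub]
      · rw [if_pos (hn.2 h'), if_neg h, if_neg h', if_pos (by omega), sub_self]
  have hpos : Set.InjOn (fun k : ℕ => (k : ℤ)) A := Nat.cast_injective.injOn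
  have hneg : Set.InjOn (fun k : ℕ => -1 - (k : ℤ)) A := fun k _ l _ h => by
    simp only at h
    omega
  have hdisj : Disjoint (A.image fun k : ℕ => (k : ℤ)) (A.image fun k : ℕ => -1 - (k : ℤ)) := by
    rw [Finset.disjoint_left]
    intro n h1 h2
    simp only [Finset.mem_image] at h1 h2
    omega
  rw [regSum, finsum_eq_sum_of_support_subset (s := (A.image fun k : ℕ => (k : ℤ)) ∪
    A.image fun k : ℕ => -1 - (k : ℤ)), Finset.sum_union hdisj, Finset.sum_image hpos,
    Finset.sum_image hneg, Finset.sum_sub_distrib, sub_eq_add_neg, ← Finset.sum_neg_distrib]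
  · congr 1
    · refine Finset.sum_congr rfl fun k hk => ?_
      rw [hex, if_pos (by omega), Int.toNat_natCast, if_pos hk, one_mul]
    · refine Finset.sum_congr rfl fun k hk => ?_
      rw [hex, if_neg (by omega), sub_sub_cancel, Int.toNat_natCast, if_pos hk, neg_one_mul]
  · intro n hn
    rw [Function.mem_support] at hn
    by_contra h
    apply hn
    simp only [Finset.coe_union, Finset.coe_image, Set.mem_union, Set.mem_image, Finset.mem_coe,
      not_or, not_exists, not_and] at h
    rw [hex]
    by_cases h0 : 0 ≤ n
    · rw [if_pos h0, if_neg fun h' => h.1 _ h' (by omega), zero_mul]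
    · rw [if_neg h0, if_neg fun h' => h.2 _ h' (by omega), zero_mul]

/-- Each `k ∈ A` is the arm and leg of a diagonal box, whose hook has `2k + 1` boxes; in
`bgRank_diagonalEquiv` the signs over that hook add up to `(-1)^k`. -/
theorem card_diagonalEquiv (A : Finset ℕ) :
    (diagonalEquiv A).1.card = ∑ k ∈ A, (2 * k + 1) := by
  zify
  rw [card_eq_regSum]
  change regSum _ (maya 0 (diagonalPartition A).1) = _
  rw [maya_diagonalPartition, regSum_selfConjMaya]
  exact Finset.sum_congr rfl fun k _ => by ring

theorem bgRank_diagonalEquiv (A : Finset ℕ) :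
    bgRank (diagonalEquiv A).1 = ∑ k ∈ A, (-1) ^ k := by
  rw [bgRank_eq_regSum]
  change regSum _ (maya 0 (diagonalPartition A).1) = _
  rw [maya_diagonalPartition, regSum_selfConjMaya]
  refine Finset.sum_congr rfl fun k _ => ?_
  have h1 : Even (-1 - (k : ℤ)) ↔ ¬ Even k := by
    rw [Int.even_sub, Int.even_coe_nat]; simp
  rw [neg_one_pow_eq_ite]
  simp only [h1, Int.even_coe_nat]
  split_ifs <;> simp_all

/-! ### Euler's product for the number of partitions -/

/-- The Young diagrams of size `n` correspond to the partitions of `n`. -/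
theorem card_youngDiagram_eq_card_partition (n : ℕ) :
    (finiteFibres_youngDiagram_card n).toFinset.card = Fintype.card n.Partition := by
  have hsum : ∀ μ : YoungDiagram, (μ.rowLens : Multiset ℕ).sum = μ.card := by
    intro μ
    rw [Multiset.sum_coe, YoungDiagram.rowLens, YoungDiagram.card, Finset.card_eq_sum_ones,
      sum_cells]
    simp only [Finset.sum_const, Finset.card_range, smul_eq_mul, mul_one]
    rfl
  rw [← Finset.card_univ]
  refine Finset.card_bij (fun μ hμ => ⟨(μ.rowLens : Multiset ℕ), fun h =>
    μ.pos_of_mem_rowLens _ (by simpa using h), ?_⟩) ?_ ?_ ?_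
  · rw [hsum]
    simpa using hμ
  · intros
    exact Finset.mem_univ _
  · intro μ _ ν _ h
    simp only [Nat.Partition.mk.injEq, Multiset.coe_eq_coe] at h
    have h' := h.eq_of_sortedGE μ.rowLens_sorted ν.rowLens_sorted
    exact YoungDiagram.equivListRowLens.injective (Subtype.ext h')
  · rintro ⟨p, hpos, rfl⟩ -
    let w := p.sort (· ≥ ·)
    have hw : w.SortedGE := (Multiset.pairwise_sort p (· ≥ ·)).sortedGE
    have hpos' : ∀ x ∈ w, 0 < x := fun x hx => hpos ((Multiset.mem_sort _).1 hx)
    have hrow := YoungDiagram.rowLens_ofRowLens_eq_self (hw := hw) hpos'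
    refine ⟨YoungDiagram.ofRowLens w hw, ?_, ?_⟩
    · simp only [Set.Finite.mem_toFinset, Set.mem_ofPred_eq]
      rw [← hsum, hrow, Multiset.sort_eq]
    · simp only [hrow]
      congr 1
      exact Multiset.sort_eq p _

variable {R : Type*} [CommRing R]

open scoped PowerSeries.WithPiTopology in
theorem weightedSeries_card_mul_qPochInf :
    weightedSeries YoungDiagram.card (fun _ => (1 : R)) * qPochInf (X : R⟦X⟧) X = 1 := by
  let _ : TopologicalSpace R := ⊥
  have _ : DiscreteTopology R := ⟨rfl⟩
  have h1 := Nat.Partition.hasProd_powerSeriesMk_card_restricted R (fun _ => True)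
  have h2 := hasProd_qPochInf (X : R⟦X⟧) X (by simp)
  have h3 := h1.mul h2
  have h4 : (PowerSeries.mk fun n => ((Nat.Partition.restricted n fun _ => True).card : R)) =
      weightedSeries YoungDiagram.card (fun _ => (1 : R)) := by
    ext n
    rw [coeff_mk, coeff_weightedSeries finiteFibres_youngDiagram_card, Finset.sum_const,
      card_youngDiagram_eq_card_partition, nsmul_one]
    simp [Nat.Partition.restricted]
  rw [← h4]
  refine h3.unique ?_
  convert hasProd_one using 1
  -- Factor by factor, the geometric series in `q^(i+1)` cancels `1 - q^(i+1)`.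
  ext1 i
  have h5 := PowerSeries.WithPiTopology.tsum_pow_mul_one_sub_of_constantCoeff_eq_zero
    (f := (X : R⟦X⟧) ^ (i + 1)) (by simp)
  simp only [if_true, pow_mul]
  rw [← pow_succ', h5]

open scoped PowerSeries.WithPiTopology in
theorem qPochInf_subst {N : ℕ} (hN : 0 < N) :
    (qPochInf (X : R⟦X⟧) X).subst (X ^ N : R⟦X⟧) = qPochInf (X ^ N : R⟦X⟧) (X ^ N) := by
  let _ : UniformSpace R := ⊥
  have _ : DiscreteUniformity R := ⟨rfl⟩
  have hsub : HasSubst (X ^ N : R⟦X⟧) := HasSubst.X_pow hN.ne'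
  have h1 := hasProd_qPochInf (X : R⟦X⟧) X (by simp)
  have h2 := hasProd_qPochInf (X ^ N : R⟦X⟧) (X ^ N) (by simp [hN.ne'])
  have hcont : Continuous (substAlgHom (R := R) hsub) := by
    rw [coe_substAlgHom]
    exact MvPowerSeries.continuous_subst hsub.const
  have h3 := h1.map (substAlgHom (R := R) hsub) hcont
  rw [coe_substAlgHom] at h3
  refine h3.unique ?_
  convert h2 using 1
  ext1 j
  simp only [Function.comp]
  rw [← coe_substAlgHom hsub]
  simp only [map_sub, map_one, map_mul, map_pow, substAlgHom_X]

theorem weightedSeries_mul_card_mul_qPochInf {N : ℕ} (hN : 0 < N) :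
    weightedSeries (fun μ : YoungDiagram => N * μ.card) (fun _ => (1 : R)) *
      qPochInf (X ^ N : R⟦X⟧) (X ^ N) = 1 := by
  have h := weightedSeries_subst finiteFibres_youngDiagram_card (fun _ => (1 : R)) 1 hN
  simp only [map_one, one_mul, one_pow] at h
  have hsub : HasSubst (X ^ N : R⟦X⟧) := HasSubst.X_pow hN.ne'
  rw [← h, ← qPochInf_subst hN, ← subst_mul hsub, weightedSeries_card_mul_qPochInf,
    ← coe_substAlgHom hsub, map_one]

/-! ### Self-conjugate partitions by size and BG-rank -/

theorem finiteFibres_diagonal : FiniteFibres fun A : Finset ℕ => ∑ k ∈ A, (2 * k + 1) := by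
  have h := (finiteFibres_card SC).comp_injective diagonalEquiv.injective
  simpa only [card_diagonalEquiv] using h

open scoped PowerSeries.WithPiTopology in
-- Expanding `∏ (1 + b^{(-1)^k} q^{2k+1})` over finite sets of `k` gives the sum over `SC`. Even `k`
-- yield the exponents `4j + 1`, odd `k` the exponents `4j + 3`.
theorem genFun_SC_bgRank (b : Rˣ) :
    genFun SC (fun μ => ((b ^ bgRank μ : Rˣ) : R)) =
      qPochInf (-(C (b : R) * X)) (X ^ 4) * qPochInf (-(C ((b⁻¹ : Rˣ) : R) * X ^ 3)) (X ^ 4) := by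
  let _ : TopologicalSpace R := ⊥
  have _ : DiscreteTopology R := ⟨rfl⟩
  rw [genFun_eq_weightedSeries, ← weightedSeries_equiv diagonalEquiv]
  simp only [card_diagonalEquiv, bgRank_diagonalEquiv]
  have h1 := hasSum_weightedSeries finiteFibres_diagonal
    fun A => ((b ^ (∑ k ∈ A, (-1) ^ k : ℤ) : Rˣ) : R)
  have h2 : (fun A : Finset ℕ => C ((b ^ (∑ k ∈ A, (-1) ^ k : ℤ) : Rˣ) : R) *
      X ^ ∑ k ∈ A, (2 * k + 1)) = fun A => ∏ k ∈ A,
        (C ((b ^ ((-1) ^ k : ℤ) : Rˣ) : R) * X ^ (2 * k + 1)) := by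
    ext1 A
    rw [Finset.prod_mul_distrib, Finset.prod_pow_eq_pow_sum, ← map_prod]
    congr 2
    rw [← Units.coe_prod]
    congr 1
    induction A using Finset.induction_on with
    | empty => simp
    | insert a s ha ih => rw [Finset.sum_insert ha, Finset.prod_insert ha, zpow_add, ih]
  rw [h2] at h1
  have h3 := hasProd_one_add_of_hasSum_prod h1
  refine h3.unique ?_
  have h4 := hasProd_qPochInf (-(C (b : R) * X)) (X ^ 4) (by simp)
  have h5 := hasProd_qPochInf (-(C ((b⁻¹ : Rˣ) : R) * X ^ 3)) (X ^ 4) (by simp)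
  have h6 : (fun j => 1 - -(C (b : R) * X) * (X ^ 4) ^ j) =
      fun j => 1 + C ((b ^ ((-1) ^ (2 * j) : ℤ) : Rˣ) : R) * X ^ (2 * (2 * j) + 1) := by
    ext1 j
    rw [pow_mul (-1 : ℤ), neg_one_sq, one_pow, zpow_one]
    ring
  have h7 : (fun j => 1 - -(C ((b⁻¹ : Rˣ) : R) * X ^ 3) * (X ^ 4) ^ j) =
      fun j => 1 + C ((b ^ ((-1) ^ (2 * j + 1) : ℤ) : Rˣ) : R) * X ^ (2 * (2 * j + 1) + 1) := by
    ext1 j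
    rw [pow_succ (-1 : ℤ), pow_mul (-1 : ℤ), neg_one_sq, one_pow, one_mul, zpow_neg_one]
    ring
  rw [h6] at h4
  rw [h7] at h5
  exact HasProd.even_mul_odd h4 h5

/-! ### The multiplication formula -/

/-- The generating series of the charges in residue class `r` modulo `2 * m`. -/
def coreSeries (m r : ℕ) (b : Rˣ) : R⟦X⟧ :=
  weightedSeries (coreSize m r) fun c => ((b ^ ((-1) ^ r * c) : Rˣ) : R)

theorem finiteFibres_mul_card {N : ℕ} (hN : 0 < N) :
    FiniteFibres fun μ : YoungDiagram => N * μ.card := by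
  intro n
  refine (finiteFibres_youngDiagram_card (n / N)).subset ?_
  rintro μ rfl
  simp [hN]

theorem finiteFibres_core {m : ℕ} (r : Fin m) :
    FiniteFibres fun p : ℤ × YoungDiagram => coreSize m r p.1 + 4 * m * p.2.card :=
  (finiteFibres_coreSize r.2).prod (finiteFibres_mul_card (by have := r.2; omega))

/-- A weight that is multiplicative in the charged quotient has a factored generating series. -/
theorem weightedSeries_SC_prod {m : ℕ} (hm : 0 < m) (b : Rˣ) (w : Fin m → YoungDiagram → R) :
    weightedSeries (fun μ : SC => μ.1.card) (fun μ => ((b ^ bgRank μ.1 : Rˣ) : R) *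
      ∏ r, w r (chargedQuotientEquiv hm μ r).2) =
    (∏ r : Fin m, coreSeries m r b) *
      ∏ r, weightedSeries (fun ν : YoungDiagram => 4 * m * ν.card) (w r) := by
  have h1 : ∀ r : Fin m, weightedSeries
      (fun p : ℤ × YoungDiagram => coreSize m r p.1 + 4 * m * p.2.card)
      (fun p => ((b ^ ((-1) ^ (r : ℕ) * p.1) : Rˣ) : R) * w r p.2) =
      coreSeries m r b * weightedSeries (fun ν : YoungDiagram => 4 * m * ν.card) (w r) :=
    fun r => weightedSeries_mul (finiteFibres_coreSize r.2)
      (finiteFibres_mul_card (N := 4 * m) (by omega))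
      (fun c => ((b ^ ((-1) ^ (r : ℕ) * c) : Rˣ) : R)) (w r)
  have h2 : ∀ μ : SC, ((b ^ bgRank μ.1 : Rˣ) : R) =
      ∏ r : Fin m, ((b ^ ((-1) ^ (r : ℕ) * (chargedQuotientEquiv hm μ r).1) : Rˣ) : R) := by
    intro μ
    rw [bgRank_eq_sum hm, ← Units.coe_prod]
    congr 1
    generalize (Finset.univ : Finset (Fin m)) = A
    induction A using Finset.induction_on with
    | empty => simp
    | insert a s ha ih => rw [Finset.sum_insert ha, Finset.prod_insert ha, zpow_add, ih]
  rw [← Finset.prod_mul_distrib, ← Finset.prod_congr rfl fun r _ => h1 r,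
    ← weightedSeries_pi finiteFibres_core, ← weightedSeries_equiv (chargedQuotientEquiv hm)]
  simp only [card_eq_sum hm, h2, Finset.prod_mul_distrib]

/-- Apply the factorization with trivial quotient weights and multiply by the inverse of the `m`
partition series in `q^{4m}`. -/
theorem prod_coreSeries {m : ℕ} (hm : 0 < m) (b : Rˣ) :
    ∏ r : Fin m, coreSeries m r b = qPochInf (X ^ (4 * m) : R⟦X⟧) (X ^ (4 * m)) ^ m *
      (qPochInf (-(C (b : R) * X)) (X ^ 4) *
        qPochInf (-(C ((b⁻¹ : Rˣ) : R) * X ^ 3)) (X ^ 4)) := by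
  have h1 := weightedSeries_SC_prod hm b fun _ _ => 1
  simp only [Finset.prod_const_one, mul_one, Finset.prod_const, Finset.card_univ,
    Fintype.card_fin] at h1
  have h2 := weightedSeries_mul_card_mul_qPochInf (R := R) (N := 4 * m) (by omega)
  rw [← genFun_SC_bgRank, genFun_eq_weightedSeries, h1, mul_comm, mul_assoc, ← mul_pow, h2,
    one_pow, mul_one]

theorem card_hooks (μ : YoungDiagram) : (hooks μ).card = μ.card := by
  simp [hooks]

theorem weightedSeries_SC_hooksMod {m : ℕ} (hm : 0 < m) (ρ₁ ρ₂ : ℕ → R) (x : R) (b : Rˣ) :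
    genFun SC (fun μ => x ^ (hooksMod (2 * m) μ).card * ((b ^ bgRank μ : Rˣ) : R) *
      (((hooksMod (2 * m) μ).map ρ₁).prod * ((hooksMod (2 * m) μ).map ρ₂).sum)) =
    (∏ r : Fin m, coreSeries m r b) * ((2 * m : ℕ) *
      ((fSeries (2 * m) ρ₁).subst (C (x ^ 2) * X ^ (4 * m) : R⟦X⟧) ^ (m - 1) *
        (gSeries (2 * m) ρ₁ ρ₂).subst (C (x ^ 2) * X ^ (4 * m) : R⟦X⟧))) := by
  classical
  -- As `H_t` contains every quotient hook twice, `x` and `ρ₁` enter squared; `W` absorbs both.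
  obtain ⟨W, hW⟩ : ∃ W : YoungDiagram → R, W = fun ν => (x ^ 2) ^ ν.card *
    ((hooks ν).map fun h => ρ₁ (2 * m * h) ^ 2).prod := ⟨_, rfl⟩
  obtain ⟨V, hV⟩ : ∃ V : YoungDiagram → R, V = fun ν =>
    ((hooks ν).map fun h => ρ₂ (2 * m * h)).sum := ⟨_, rfl⟩
  have hf : (fSeries (2 * m) ρ₁).subst (C (x ^ 2) * X ^ (4 * m) : R⟦X⟧) =
      weightedSeries (fun ν => 4 * m * ν.card) W := by
    rw [fSeries, genFun_univ, weightedSeries_subst finiteFibres_youngDiagram_card _ _ (by omega),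
      hW]
  have hg : (gSeries (2 * m) ρ₁ ρ₂).subst (C (x ^ 2) * X ^ (4 * m) : R⟦X⟧) =
      weightedSeries (fun ν => 4 * m * ν.card) fun ν => W ν * V ν := by
    rw [gSeries, genFun_univ, weightedSeries_subst finiteFibres_youngDiagram_card _ _ (by omega),
      hW, hV]
    simp only [mul_assoc]
  -- The sum of `ρ₂` becomes a sum over the marked component `s`, so that each summand is a product
  -- over `r`.
  have hw : ∀ μ : SC, x ^ (hooksMod (2 * m) μ.1).card * ((b ^ bgRank μ.1 : Rˣ) : R) *
      (((hooksMod (2 * m) μ.1).map ρ₁).prod * ((hooksMod (2 * m) μ.1).map ρ₂).sum) =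
      ∑ s : Fin m, ((b ^ bgRank μ.1 : Rˣ) : R) *
        ∏ r, W (chargedQuotientEquiv hm μ r).2 *
          if r = s then 2 * V (chargedQuotientEquiv hm μ r).2 else 1 := by
    intro μ
    rw [hooksMod_eq_sum hm]
    generalize chargedQuotientEquiv hm μ = v
    have h1 : (∑ r : Fin m, 2 • (hooks (v r).2).map (2 * m * ·)).card =
        ∑ r : Fin m, 2 * (v r).2.card := by
      simp [card_hooks]
    have h2 : ((∑ r : Fin m, 2 • (hooks (v r).2).map (2 * m * ·)).map ρ₁).prod =
        ∏ r : Fin m, ((hooks (v r).2).map fun h => ρ₁ (2 * m * h) ^ 2).prod := by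
      rw [← Multiset.coe_mapAddMonoidHom, map_sum, Multiset.prod_sum]
      refine Finset.prod_congr rfl fun r _ => ?_
      rw [Multiset.coe_mapAddMonoidHom, Multiset.map_nsmul, Multiset.prod_nsmul, Multiset.map_map, Multiset.prod_map_pow]
      rfl
    have h3 : ((∑ r : Fin m, 2 • (hooks (v r).2).map (2 * m * ·)).map ρ₂).sum =
        ∑ r : Fin m, 2 * V (v r).2 := by
      rw [← Multiset.coe_mapAddMonoidHom, map_sum, Multiset.sum_sum]
      refine Finset.sum_congr rfl fun r _ => ?_
      rw [Multiset.coe_mapAddMonoidHom, Multiset.map_nsmul, Multiset.sum_nsmul, Multiset.map_map, nsmul_eq_mul, hV]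
      rfl
    simp only [Finset.prod_mul_distrib, Finset.prod_ite_eq', Finset.mem_univ, if_true]
    rw [h1, h2, h3, hW]
    simp only [← Finset.mul_sum, Finset.prod_mul_distrib, Finset.prod_pow_eq_pow_sum, pow_mul]
    ring
  rw [genFun_eq_weightedSeries]
  simp only [hw]
  rw [weightedSeries_sum _ (finiteFibres_card SC)]
  have hs : ∀ s : Fin m, weightedSeries (fun μ : SC => μ.1.card) (fun μ =>
      ((b ^ bgRank μ.1 : Rˣ) : R) * ∏ r, W (chargedQuotientEquiv hm μ r).2 *
        if r = s then 2 * V (chargedQuotientEquiv hm μ r).2 else 1) =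
      (∏ r : Fin m, coreSeries m r b) * (2 *
        (weightedSeries (fun ν => 4 * m * ν.card) W ^ (m - 1) *
          weightedSeries (fun ν => 4 * m * ν.card) fun ν => W ν * V ν)) := by
    intro s
    rw [weightedSeries_SC_prod hm b fun r ν => W ν * if r = s then 2 * V ν else 1]
    congr 1
    rw [← Finset.mul_prod_erase _ _ (Finset.mem_univ s), Finset.prod_congr rfl
      (g := fun _ => weightedSeries (fun ν => 4 * m * ν.card) W)]
    · simp only [if_true, Finset.prod_const, Finset.card_erase_of_mem (Finset.mem_univ s),
        Finset.card_univ, Fintype.card_fin]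
      have := weightedSeries_smul (finiteFibres_mul_card (N := 4 * m) (by omega)) (2 : R)
        fun ν => W ν * V ν
      simp only [mul_left_comm (2 : R)] at this
      rw [this, map_ofNat]
      ring
    · intro r hr
      simp only [if_neg (Finset.ne_of_mem_erase hr), mul_one]
  rw [Finset.sum_congr rfl fun s _ => hs s, Finset.sum_const, Finset.card_univ, Fintype.card_fin,
    nsmul_eq_mul, hf, hg]
  push_cast
  ring

end SelfConj

end

theorem theorem1p2 {R : Type*} [CommRing R] (t : ℕ) (ht : 0 < t) (hteven : Even t)
    (ρ₁ ρ₂ : ℕ → R) (x : R) (b : Rˣ) :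
    SelfConj.genFun SelfConj.SC (fun μ =>
        x ^ (SelfConj.hooksMod t μ).card * ((b ^ SelfConj.bgRank μ : Rˣ) : R) *
          (((SelfConj.hooksMod t μ).map ρ₁).prod * ((SelfConj.hooksMod t μ).map ρ₂).sum)) =
      (t : PowerSeries R) *
        (SelfConj.fSeries t ρ₁).subst
          (PowerSeries.C (x ^ 2) * PowerSeries.X ^ (2 * t) : PowerSeries R) ^ (t / 2 - 1) *
        (SelfConj.gSeries t ρ₁ ρ₂).subst
          (PowerSeries.C (x ^ 2) * PowerSeries.X ^ (2 * t) : PowerSeries R) *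
        SelfConj.qPochInf (PowerSeries.X ^ (2 * t)) (PowerSeries.X ^ (2 * t)) ^ (t / 2) *
        SelfConj.qPochInf (-(PowerSeries.C (b : R) * PowerSeries.X)) (PowerSeries.X ^ 4) *
        SelfConj.qPochInf (-(PowerSeries.C ((b⁻¹ : Rˣ) : R) * PowerSeries.X ^ 3))
          (PowerSeries.X ^ 4) := by
  obtain ⟨m, rfl⟩ := even_iff_exists_two_mul.1 hteven
  have hm : 0 < m := by omega
  rw [SelfConj.weightedSeries_SC_hooksMod hm, SelfConj.prod_coreSeries hm,
    show 2 * m / 2 = m by omega, show 2 * (2 * m) = 4 * m by ring]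
  ring
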